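/- **Theorem.** Work in $\mathbb{R}^d$, $d\ge 3$, with the $\ell_1$-norm, and let $\mathbb{B}_1^d=\{x:\|x\|_1<1\}$. Let $\mathcal X\subseteq\mathbb{R}^d$ be compact and convex. A (randomized) *two-point-feedback algorithm* on $\mathcal X$ chooses in each round $t=1,2,\dots$ two points $x_t^+,x_t^-\in\mathcal X$ as a measurable function of its internal randomness and of the feedback $(f_s(x_s^+),f_s(x_s^-))_{s<t}$ from the earlier rounds. The path variation of $u_1,\dots,u_T$ is $\mathcal P_{T,1}=\sum_{t=1}^{T-1}\|u_{t+1}-u_t\|_1$. There is an absolute constant $C>0$ such that for every $d\ge 3$ there is a compact convex set $\mathcal X$ with $r\,\mathbb{B}_1^d\subseteq\mathcal X\subseteq\mathbb{B}_1^d$ for some $r>0$ and with the following property. Let $T\ge 1$ be an integer and let $P$ be a real number with $0\le P\le\min\{T-1,\;T/d\}$. Then for every two-point-feedback algorithm on $\mathcal X$ there exist convex functions $f_1,\dots,f_T:\mathbb{R}^d\to\mathbb{R}$ satisfying $$|f_t(x)-f_t(y)|\le \frac{1}{\sqrt{\log d}}\,\|x-y\|_1\qquad (x,y\in\mathcal X,\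 1\le t\le T)$$ and comparators $u_1,\dots,u_T\in\mathcal X$ with path variation $\mathcal P_{T,1}=P$ such that the dynamic regret of the algorithm is integrable and $$\mathbb{E}\left[\sum_{t=1}^T\frac{f_t(x_t^+)+f_t(x_t^-)}{2}-\sum_{t=1}^T f_t(u_t)\right]\ \ge\ C\sqrt{d\,(\log d)^{-1}\,\mathcal P_{T,1}\,T},$$ where the expectation is over the randomness of the algorithm. -/

import Mathlib

open MeasureTheory

noncomputable section

namespace BCO

/-- `ℝ^d` equipped with the `ℓ₁`-norm. -/
abbrev L1Space (d : ℕ) : Type := PiLp 1 (fun _ : Fin d => ℝ)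

/-- A (possibly randomized) algorithm for bandit convex optimization with two-point feedback on the
feasible set `X`. All its internal randomness is carried by a seed in `Ω`. In round `t` (rounds are
numbered from `0`) it chooses two points of `X` as a measurable function of the seed and of the pairs
of loss values observed in the rounds before `t`; these are the only information on the losses that
it has. (The earlier decisions are themselves functions of the seed and of that feedback.) -/
structure TwoPointAlgorithm (d : ℕ) (X : Set (L1Space d)) (Ω : Type*) [MeasurableSpace Ω] where
  play : (t : ℕ) → Ω → (Fin t → ℝ × ℝ) → L1Space d × L1Space d
  measurable_play : ∀ t,
    Measurable (fun p : Ω × (Fin t → ℝ × ℝ) => play t p.1 p.2)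
  fst_mem : ∀ t ω h, (play t ω h).1 ∈ X
  snd_mem : ∀ t ω h, (play t ω h).2 ∈ X

namespace TwoPointAlgorithm

variable {d : ℕ} {X : Set (L1Space d)} {Ω : Type*} [MeasurableSpace Ω]

/-- The feedback observed before round `t` when the algorithm is run with seed `ω` against the losses
`f`: for each earlier round `s`, the two values of `f s` at the points played in round `s`. -/
def feedback (A : TwoPointAlgorithm d X Ω) (f : ℕ → L1Space d → ℝ) (ω : Ω) :
    (t : ℕ) → Fin t → ℝ × ℝ
  | 0 => fun i => i.elim0
  | t + 1 =>
      Fin.snoc (α := fun _ => ℝ × ℝ) (A.feedback f ω t)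
        (f t (A.play t ω (A.feedback f ω t)).1, f t (A.play t ω (A.feedback f ω t)).2)

/-- The pair of points `(x_t⁺, x_t⁻)` played in round `t`. -/
def output (A : TwoPointAlgorithm d X Ω) (f : ℕ → L1Space d → ℝ) (t : ℕ) (ω : Ω) :
    L1Space d × L1Space d :=
  A.play t ω (A.feedback f ω t)

/-- The dynamic regret over `T` rounds against the comparators `u`, for the seed `ω`. -/
def dynamicRegret (A : TwoPointAlgorithm d X Ω) (T : ℕ) (f : ℕ → L1Space d → ℝ)
    (u : ℕ → L1Space d) (ω : Ω) : ℝ :=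
  ∑ t ∈ Finset.range T, (f t (A.output f t ω).1 + f t (A.output f t ω).2) / 2
    - ∑ t ∈ Finset.range T, f t (u t)

end TwoPointAlgorithm

/-- The `ℓ₁` path variation of the comparators `u 0, …, u (T - 1)`. -/
def pathVariation {d : ℕ} (T : ℕ) (u : ℕ → L1Space d) : ℝ :=
  ∑ t ∈ Finset.range (T - 1), ‖u (t + 1) - u t‖

/-- A compact convex feasible set which contains an open `ℓ₁`-ball around the origin and is contained
in the open unit `ℓ₁`-ball. -/
structure IsFeasibleSet {d : ℕ} (X : Set (L1Space d)) : Prop where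
  isCompact : IsCompact X
  convex : Convex ℝ X
  exists_ball_subset : ∃ r : ℝ, 0 < r ∧ Metric.ball 0 r ⊆ X
  subset_ball : X ⊆ Metric.ball 0 1

/-- A convex loss on `ℝ^d` that is `G`-Lipschitz on `X` with respect to the `ℓ₁`-norm. -/
structure IsLoss {d : ℕ} (X : Set (L1Space d)) (G : ℝ) (f : L1Space d → ℝ) : Prop where
  convexOn : ConvexOn ℝ Set.univ f
  lipschitz : ∀ x ∈ X, ∀ y ∈ X, |f x - f y| ≤ G * ‖x - y‖

end BCO

end

/-!
The hard losses are linear, `f t x = (G / 2) ⟪ζ t - θ t, x⟫`, where the coordinates of the noise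
`ζ t` are independent, centred and bounded by `1`, and the drift `θ t = ± ε` has signs that are
constant on blocks of rounds. Compared with the comparator that follows the signs, an
algorithm that does not know them has regret of order `G ε` per round, so it suffices that two values
per round reveal little about the signs.

*Information.* Two evaluations of a linear loss only see `ζ t` through its projection onto the span of
the two points played. Hence flipping the sign of one drift coordinate `i` is undone, as far as the
feedback is concerned, by shifting `ζ t` by a multiple of the projection of the basis vector `e i`
onto that span (`projSpan`, `TwoPointAlgorithm.output_shear`). This shift depends on the past noise
only, so it is a volume preserving shear of noise space, and the total squared length of the
projections over `i` is at most the rank, `2` (`sum_sum_sq_projSpan_le`). The distance between the two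
worlds is therefore a distance between the law of the noise and its image under a shear. With Gaussian
noise this would be a Girsanov computation, but the Lipschitz constraint forces bounded noise, for
which the relative entropy of a shift is infinite. The Hellinger distance is finite and quadratic in
the shift as soon as the square root of the noise density is Lipschitz with compact support; the
tent function is used for it. `hellinger_shear_le` adds these one-round bounds up along the shear.

*Averaging.* Averaging over all sign patterns, and using that the projections have total squared
length at most `2` in each round, gives regret of order `G ε T` when `ε ^ 2` is at most a small
multiple of `d / L`, with `L` the block length (`TwoPointAlgorithm.sum_signs_noiseMean_regret_ge`).
The noise and the signs are fixed by the first moment method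
(`TwoPointAlgorithm.exists_signs_noise_le_integral`).

*Path variation.* The feasible set is a box whose last `d - 1` coordinates are bounded by `1 / (2 d)`,
so a change of all signs costs less than `1` and `⌊P⌋ + 1` blocks are affordable. The losses ignore
coordinate `0`, on which the box has width independent of `d`: the comparators oscillate there to use
up exactly what remains of `P`.
-/

noncomputable section

namespace BCO

/-! ### Compactly supported noise that tolerates shifts -/

section

/-- The square root of the noise density: a tent on `[-1, 1]`, normalised in `L²`. -/
def tent (x : ℝ) : ℝ := √(3 / 2) * max 0 (1 - |x|)

lemma tent_nonneg (x : ℝ) : 0 ≤ tent x := by unfold tent; positivity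

@[fun_prop]
lemma continuous_tent : Continuous tent := by unfold tent; fun_prop

lemma tent_eq_zero {x : ℝ} (hx : 1 ≤ |x|) : tent x = 0 := by
  simp [tent, max_eq_left (sub_nonpos.2 hx)]

lemma abs_le_one_of_tent_ne_zero {x : ℝ} (hx : tent x ≠ 0) : |x| ≤ 1 := by
  by_contra! h
  exact hx (tent_eq_zero h.le)

lemma tent_neg (x : ℝ) : tent (-x) = tent x := by simp [tent]

lemma sq_tent_sub_tent_le (x y : ℝ) : (tent x - tent y) ^ 2 ≤ 3 / 2 * (x - y) ^ 2 := by
  have h : |max 0 (1 - |x|) - max 0 (1 - |y|)| ≤ |x - y| := by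
    calc _ ≤ |(1 - |x|) - (1 - |y|)| := by
          simpa using abs_max_sub_max_le_max 0 (1 - |x|) 0 (1 - |y|)
      _ = |(|y| - |x|)| := by ring_nf
      _ ≤ |y - x| := abs_abs_sub_abs_le y x
      _ = _ := abs_sub_comm y x
  have h2 := sq_le_sq.2 h
  unfold tent
  rw [← mul_sub, mul_pow, Real.sq_sqrt (by norm_num)]
  gcongr

lemma hasCompactSupport_tent : HasCompactSupport tent :=
  HasCompactSupport.intro (isCompact_Icc (a := (-1 : ℝ)) (b := 1)) fun x hx => by
    apply tent_eq_zero
    by_contra! h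
    exact hx ⟨(abs_le.1 h.le).1, (abs_le.1 h.le).2⟩

lemma integrable_tent_mul_tent (θ : ℝ) : Integrable fun y => tent y * tent (y + θ) :=
  Continuous.integrable_of_hasCompactSupport (by fun_prop) hasCompactSupport_tent.mul_right

lemma integrable_tent_sq : Integrable fun y => tent y ^ 2 := by
  simpa [sq] using integrable_tent_mul_tent 0

lemma integral_tent_sq : ∫ y, tent y ^ 2 = 1 := by
  have h1 : (fun y => tent y ^ 2) = fun y => (fun r => 3 / 2 * max 0 (1 - r) ^ 2) |y| := by
    ext y; simp only [tent, mul_pow]; rw [Real.sq_sqrt (by norm_num)]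
  rw [h1, integral_comp_abs (f := fun r => 3 / 2 * max 0 (1 - r) ^ 2)]
  have h2 : ∫ r in Set.Ioi (0 : ℝ), 3 / 2 * max 0 (1 - r) ^ 2
      = ∫ r in Set.Ioc (0 : ℝ) 1, 3 / 2 * max 0 (1 - r) ^ 2 := by
    refine setIntegral_eq_of_subset_of_forall_sdiff_eq_zero measurableSet_Ioi
      (fun x hx => hx.1) fun x hx => ?_
    have : 1 ≤ x := by
      by_contra! h
      exact hx.2 ⟨hx.1, h.le⟩
    simp [max_eq_left (sub_nonpos.2 this)]
  have h3 : ∫ r in Set.Ioc (0 : ℝ) 1, 3 / 2 * max 0 (1 - r) ^ 2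
      = ∫ r in (0 : ℝ)..1, 3 / 2 * (1 - r) ^ 2 := by
    rw [intervalIntegral.integral_of_le zero_le_one]
    refine setIntegral_congr_fun measurableSet_Ioc fun x hx => ?_
    simp [max_eq_right (sub_nonneg.2 hx.2)]
  rw [h2, h3, intervalIntegral.integral_const_mul,
    intervalIntegral.integral_comp_sub_left (fun x => x ^ 2) 1]
  norm_num

/-- The tent is `√(3/2)`-Lipschitz, and its difference with a translate lives on two intervals of
length `2`. -/
lemma integral_sq_tent_sub_le (θ : ℝ) : ∫ y, (tent y - tent (y + θ)) ^ 2 ≤ 6 * θ ^ 2 := by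
  let g : ℝ → ℝ := fun y => (Set.Icc (-1 : ℝ) 1).indicator (fun _ => 3 / 2 * θ ^ 2) y
    + (Set.Icc (-1 - θ) (1 - θ)).indicator (fun _ => 3 / 2 * θ ^ 2) y
  have hi1 : Integrable ((Set.Icc (-1 : ℝ) 1).indicator (fun _ => 3 / 2 * θ ^ 2)) :=
    (integrable_indicator_iff measurableSet_Icc).2
      (continuousOn_const.integrableOn_compact isCompact_Icc)
  have hi2 : Integrable ((Set.Icc (-1 - θ) (1 - θ)).indicator (fun _ => 3 / 2 * θ ^ 2)) :=
    (integrable_indicator_iff measurableSet_Icc).2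
      (continuousOn_const.integrableOn_compact isCompact_Icc)
  have hg : ∫ y, g y = 6 * θ ^ 2 := by
    rw [integral_add hi1 hi2, integral_indicator measurableSet_Icc,
      integral_indicator measurableSet_Icc]
    simp [Measure.real]
    ring
  rw [← hg]
  refine integral_mono_of_nonneg (ae_of_all _ fun y => sq_nonneg _) (hi1.add hi2)
    (ae_of_all _ fun y => ?_)
  have hθ := sq_tent_sub_tent_le y (y + θ)
  have h0 : (0 : ℝ) ≤ 3 / 2 * θ ^ 2 := by positivity
  rw [show y - (y + θ) = -θ by ring, neg_sq] at hθ
  by_cases h1 : y ∈ Set.Icc (-1 : ℝ) 1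
  · simp only [g, Set.indicator_of_mem h1]
    exact hθ.trans (le_add_of_nonneg_right (Set.indicator_nonneg (fun _ _ => h0) _))
  · by_cases h2 : y ∈ Set.Icc (-1 - θ) (1 - θ)
    · simp only [g, Set.indicator_of_mem h2, Set.indicator_of_notMem h1, zero_add]
      exact hθ
    · have t1 : tent y = 0 := by
        by_contra h
        exact h1 (abs_le.1 (abs_le_one_of_tent_ne_zero h))
      have t2 : tent (y + θ) = 0 := by
        by_contra h
        have := abs_le.1 (abs_le_one_of_tent_ne_zero h)
        exact h2 ⟨by linarith, by linarith⟩
      simp [g, h1, h2, t1, t2]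

/-- The Hellinger affinity of the noise law and its translate by `θ` is `1 - O(θ ^ 2)`. -/
lemma affinity_tent (θ : ℝ) :
    1 - 3 * θ ^ 2 ≤ ∫ y, tent y * tent (y + θ) ∧ ∫ y, tent y * tent (y + θ) ≤ 1 := by
  have hs : Integrable fun y => tent (y + θ) ^ 2 := integrable_tent_sq.comp_add_right θ
  have e : ∫ y, (tent y - tent (y + θ)) ^ 2 = 2 - 2 * ∫ y, tent y * tent (y + θ) := by
    have : (fun y => (tent y - tent (y + θ)) ^ 2)
        = fun y => (tent y ^ 2 + tent (y + θ) ^ 2) - 2 * (tent y * tent (y + θ)) := by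
      ext y; ring
    have hsum : Integrable fun y => tent y ^ 2 + tent (y + θ) ^ 2 := integrable_tent_sq.add hs
    rw [this, integral_sub hsum ((integrable_tent_mul_tent θ).const_mul 2), 
      integral_add integrable_tent_sq hs,
      integral_const_mul, integral_add_right_eq_self (fun y => tent y ^ 2) θ, integral_tent_sq]
    ring
  have := integral_sq_tent_sub_le θ
  have h0 : 0 ≤ ∫ y, (tent y - tent (y + θ)) ^ 2 := integral_nonneg fun y => sq_nonneg _
  constructor <;> linarith

lemma one_sub_sum_one_sub_le_prod {ι : Type*} (S : Finset ι) (a : ι → ℝ) (h0 : ∀ i, 0 ≤ a i)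
    (h1 : ∀ i, a i ≤ 1) : 1 - ∑ i ∈ S, (1 - a i) ≤ ∏ i ∈ S, a i := by
  classical
  induction S using Finset.induction_on with
  | empty => simp
  | insert i S hi ih =>
    rw [Finset.sum_insert hi, Finset.prod_insert hi]
    have hp : ∏ j ∈ S, a j ≤ 1 := Finset.prod_le_one (fun j _ => h0 j) fun j _ => h1 j
    nlinarith [h1 i, h0 i]

variable {n : ℕ}

/-- The square root of the density of the noise vector of one round, whose coordinates are
independent. -/
def tentProd (y : Fin n → ℝ) : ℝ := ∏ i, tent (y i)

lemma tentProd_nonneg (y : Fin n → ℝ) : 0 ≤ tentProd y :=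
  Finset.prod_nonneg fun _ _ => tent_nonneg _

lemma tentProd_neg (y : Fin n → ℝ) : tentProd (-y) = tentProd y := by simp [tentProd, tent_neg]

@[fun_prop]
lemma continuous_tentProd : Continuous (tentProd : (Fin n → ℝ) → ℝ) := by unfold tentProd; fun_prop

lemma abs_le_one_of_tentProd_ne_zero {y : Fin n → ℝ} (hy : tentProd y ≠ 0) (i : Fin n) : |y i| ≤ 1 :=
  abs_le_one_of_tent_ne_zero (Finset.prod_ne_zero_iff.1 hy i (Finset.mem_univ i))

lemma integrable_tentProd_mul_tentProd (s : Fin n → ℝ) :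
    Integrable fun y => tentProd y * tentProd (y + s) := by
  simp only [tentProd, ← Finset.prod_mul_distrib, Pi.add_apply]
  exact Integrable.fintype_prod (μ := fun _ => volume) (f := fun i y => tent y * tent (y + s i))
    fun i => integrable_tent_mul_tent (s i)

lemma integrable_tentProd_sq : Integrable fun y : Fin n → ℝ => tentProd y ^ 2 := by
  simpa [sq] using integrable_tentProd_mul_tentProd (0 : Fin n → ℝ)

lemma integral_tentProd_sq : ∫ y : Fin n → ℝ, tentProd y ^ 2 = 1 := by
  simp only [tentProd, ← Finset.prod_pow]
  rw [integral_fintype_prod_volume_eq_prod (fun (_ : Fin n) y => tent y ^ 2)]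
  simp [integral_tent_sq]

lemma affinity_tentProd_ge (s : Fin n → ℝ) :
    1 - 3 * ∑ i, s i ^ 2 ≤ ∫ y, tentProd y * tentProd (y + s) := by
  simp only [tentProd, ← Finset.prod_mul_distrib, Pi.add_apply]
  rw [integral_fintype_prod_volume_eq_prod (fun i y => tent y * tent (y + s i))]
  refine le_trans ?_ (one_sub_sum_one_sub_le_prod _ _
    (fun _ => integral_nonneg fun y => mul_nonneg (tent_nonneg _) (tent_nonneg _))
    fun i => (affinity_tent (s i)).2)
  rw [Finset.mul_sum]
  have := Finset.sum_le_sum fun i (_ : i ∈ Finset.univ) =>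
    show 1 - ∫ y, tent y * tent (y + s i) ≤ 3 * s i ^ 2 by linarith [(affinity_tent (s i)).1]
  linarith

end

/-! ### Predictable shears of the noise -/

section

variable {n : ℕ}

/-- The noise of finitely many rounds, continued by zero. -/
def extendZero {T : ℕ} (z : Fin T → Fin n → ℝ) (t : ℕ) : Fin n → ℝ :=
  if h : t < T then z ⟨t, h⟩ else 0

lemma extendZero_of_lt {T : ℕ} (z : Fin T → Fin n → ℝ) {t : ℕ} (h : t < T) :
    extendZero z t = z ⟨t, h⟩ := dif_pos h

lemma extendZero_of_le {T : ℕ} (z : Fin T → Fin n → ℝ) {t : ℕ} (h : T ≤ t) :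
    extendZero z t = 0 := dif_neg h.not_gt

lemma extendZero_snoc {T : ℕ} (z : Fin T → Fin n → ℝ) (y : Fin n → ℝ) {t : ℕ} (h : t < T) :
    extendZero (Fin.snoc z y : Fin (T + 1) → Fin n → ℝ) t = extendZero z t := by
  rw [extendZero_of_lt _ h, extendZero_of_lt _ (h.trans T.lt_succ_self)]
  exact Fin.snoc_castSucc (α := fun _ => Fin n → ℝ) y z ⟨t, h⟩

@[fun_prop]
lemma measurable_extendZero {T : ℕ} :
    Measurable (extendZero : (Fin T → Fin n → ℝ) → ℕ → Fin n → ℝ) := by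
  refine measurable_pi_iff.2 fun t => ?_
  unfold extendZero
  split_ifs <;> fun_prop

/-- A process of functions of the noise sequence whose value at round `t` depends on the noise of the
rounds before `t` only. -/
structure IsPredictable {β : Type*} [MeasurableSpace β] (s : ℕ → (ℕ → Fin n → ℝ) → β) : Prop where
  measurable : ∀ t, Measurable (s t)
  causal : ∀ t ζ ζ', (∀ j < t, ζ j = ζ' j) → s t ζ = s t ζ'

/-- The translation of the noise of each round `t < T` by the predictable amount `s t`. -/
def shear (s : ℕ → (ℕ → Fin n → ℝ) → Fin n → ℝ) (T : ℕ) (z : Fin T → Fin n → ℝ) :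
    Fin T → Fin n → ℝ := fun t => z t + s t (extendZero z)

/-- The square root of the density of the noise of `T` independent rounds. -/
def amplitude {T : ℕ} (z : Fin T → Fin n → ℝ) : ℝ := ∏ t, tentProd (z t)

lemma amplitude_nonneg {T : ℕ} (z : Fin T → Fin n → ℝ) : 0 ≤ amplitude z :=
  Finset.prod_nonneg fun _ _ => tentProd_nonneg _

@[fun_prop]
lemma continuous_amplitude {T : ℕ} : Continuous (amplitude : (Fin T → Fin n → ℝ) → ℝ) := by
  unfold amplitude; fun_prop

lemma amplitude_snoc {T : ℕ} (z : Fin T → Fin n → ℝ) (y : Fin n → ℝ) :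
    amplitude (Fin.snoc z y : Fin (T + 1) → Fin n → ℝ) = amplitude z * tentProd y := by
  simp [amplitude, Fin.prod_univ_castSucc]

lemma integrable_amplitude_sq {T : ℕ} :
    Integrable fun z : Fin T → Fin n → ℝ => amplitude z ^ 2 := by
  simp only [amplitude, ← Finset.prod_pow]
  exact Integrable.fintype_prod (μ := fun _ => volume) (f := fun _ y => tentProd y ^ 2)
    fun i => integrable_tentProd_sq

lemma integral_amplitude_sq {T : ℕ} : ∫ z : Fin T → Fin n → ℝ, amplitude z ^ 2 = 1 := by
  simp only [amplitude, ← Finset.prod_pow]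
  rw [integral_fintype_prod_volume_eq_prod (fun (_ : Fin T) (y : Fin n → ℝ) => tentProd y ^ 2)]
  simp [integral_tentProd_sq]

/-- Appending the noise of one more round. -/
def snocEquiv (n T : ℕ) :
    (Fin T → Fin n → ℝ) × (Fin n → ℝ) ≃ᵐ (Fin (T + 1) → Fin n → ℝ) :=
  MeasurableEquiv.prodComm.trans
    (MeasurableEquiv.piFinSuccAbove (fun _ : Fin (T + 1) => Fin n → ℝ) (Fin.last T)).symm

lemma snocEquiv_apply {T : ℕ} (p : (Fin T → Fin n → ℝ) × (Fin n → ℝ)) :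
    snocEquiv n T p = Fin.snoc p.1 p.2 := by
  simp [snocEquiv, MeasurableEquiv.piFinSuccAbove_symm_apply, Fin.insertNthEquiv,
    Fin.insertNth_last', MeasurableEquiv.prodComm]

lemma measurePreserving_snocEquiv (T : ℕ) :
    MeasurePreserving (snocEquiv n T) (volume.prod volume) volume :=
  (volume_preserving_piFinSuccAbove (fun _ : Fin (T + 1) => Fin n → ℝ) (Fin.last T)).symm.comp
    Measure.measurePreserving_swap

lemma integral_snoc {T : ℕ} {F : (Fin (T + 1) → Fin n → ℝ) → ℝ} (hF : Integrable F) :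
    Integrable (fun z : Fin T → Fin n → ℝ => ∫ y, F (Fin.snoc z y)) ∧
      ∫ z, F z = ∫ z : Fin T → Fin n → ℝ, ∫ y, F (Fin.snoc z y) := by
  have h1 := (measurePreserving_snocEquiv T).integrable_comp_of_integrable hF
  have h2 := (measurePreserving_snocEquiv T).integral_comp' F
  rw [integral_prod (fun p => F (snocEquiv n T p)) h1] at h2
  have h3 := h1.integral_prod_left
  simp only [Function.comp_apply, snocEquiv_apply] at h2 h3
  exact ⟨h3, h2.symm⟩

variable {s : ℕ → (ℕ → Fin n → ℝ) → Fin n → ℝ}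

lemma shear_snoc (hs : IsPredictable s) {T : ℕ} (z : Fin T → Fin n → ℝ) (y : Fin n → ℝ) :
    shear s (T + 1) (Fin.snoc z y) = Fin.snoc (shear s T z) (y + s T (extendZero z)) := by
  ext1 t
  refine Fin.lastCases ?_ (fun t => ?_) t
  · simp only [shear, Fin.snoc_last, Fin.val_last]
    rw [hs.causal T _ (extendZero z) fun j hj => extendZero_snoc z y hj]
  · simp only [shear, Fin.snoc_castSucc, Fin.val_castSucc]
    rw [hs.causal t _ (extendZero z) fun j hj => extendZero_snoc z y (hj.trans t.2)]

/-- The shear is triangular: each round is translated by a function of the earlier ones. -/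
lemma measurePreserving_shear (hs : IsPredictable s) (T : ℕ) :
    MeasurePreserving (shear s T) volume volume := by
  induction T with
  | zero =>
    convert MeasurePreserving.id (volume : Measure (Fin 0 → Fin n → ℝ)) using 1
  | succ T ih =>
    have hsk : MeasurePreserving
        (fun p : (Fin T → Fin n → ℝ) × (Fin n → ℝ) =>
          (shear s T p.1, p.2 + s T (extendZero p.1)))
        (volume.prod volume) (volume.prod volume) := by
      refine ih.skew_product (g := fun z y => y + s T (extendZero z)) ?_ (ae_of_all _ fun z => ?_)
      · exact measurable_snd.add ((hs.measurable T).comp (measurable_extendZero.comp measurable_fst))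
      · exact (measurePreserving_add_right volume _).map_eq
    have he := measurePreserving_snocEquiv (n := n) T
    convert (he.comp hsk).comp he.symm using 1
    funext z
    obtain ⟨p, rfl⟩ := (snocEquiv n T).surjective z
    simp only [Function.comp_apply, MeasurableEquiv.symm_apply_apply]
    rw [snocEquiv_apply, snocEquiv_apply, shear_snoc hs]

lemma integrable_amplitude_shear_sq (hs : IsPredictable s) (T : ℕ) :
    Integrable fun z => amplitude (shear s T z) ^ 2 :=
  (measurePreserving_shear hs T).integrable_comp_of_integrable integrable_amplitude_sq

lemma measurable_shear (hs : IsPredictable s) (T : ℕ) : Measurable (shear s T) :=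
  (measurePreserving_shear hs T).measurable

lemma integrable_amplitude_mul_amplitude_shear (hs : IsPredictable s) (T : ℕ) :
    Integrable fun z => amplitude z * amplitude (shear s T z) := by
  refine (integrable_amplitude_sq.add (integrable_amplitude_shear_sq hs T)).mono'
    ((continuous_amplitude.measurable.mul
      (continuous_amplitude.measurable.comp (measurable_shear hs T))).aestronglyMeasurable)
    (ae_of_all _ fun z => ?_)
  rw [Real.norm_of_nonneg (mul_nonneg (amplitude_nonneg _) (amplitude_nonneg _)), Pi.add_apply]
  nlinarith [sq_nonneg (amplitude z - amplitude (shear s T z)), sq_nonneg (amplitude z),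
    sq_nonneg (amplitude (shear s T z))]

lemma integral_tentProd_shift_sq (v : Fin n → ℝ) : ∫ y, tentProd (y + v) ^ 2 = 1 := by
  rw [integral_add_right_eq_self (fun y => tentProd y ^ 2) v, integral_tentProd_sq]

/-- The squared Hellinger distance between the noise law and its image under a predictable shear is
at most a constant times the expected total squared length of the shifts, with the expectation
averaged over the two laws. The geometric mean of the densities, which weighs the contribution of a new round, is bounded by
their arithmetic mean. -/
lemma hellinger_shear_le (hs : IsPredictable s) {K : ℝ} (hK : ∀ t ζ, ∑ i, s t ζ i ^ 2 ≤ K)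
    (T : ℕ) :
    1 - ∫ z, amplitude z * amplitude (shear s T z) ≤
      3 / 2 * ∑ t ∈ Finset.range T, ∫ z : Fin T → Fin n → ℝ,
        (amplitude z ^ 2 + amplitude (shear s T z) ^ 2) * ∑ i, s t (extendZero z) i ^ 2 := by
  have hmeas : ∀ T t : ℕ, Measurable fun z : Fin T → Fin n → ℝ =>
      ∑ i, s t (extendZero z) i ^ 2 := fun T t => by
    have := (hs.measurable t).comp (measurable_extendZero (n := n) (T := T))
    refine Finset.measurable_sum _ fun i _ => ?_
    exact ((measurable_pi_apply i).comp this).pow_const 2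
  have hint : ∀ T t : ℕ, Integrable fun z : Fin T → Fin n → ℝ =>
      (amplitude z ^ 2 + amplitude (shear s T z) ^ 2) * ∑ i, s t (extendZero z) i ^ 2 := fun T t => by
    refine (integrable_amplitude_sq.add (integrable_amplitude_shear_sq hs T)).mul_bdd (c := K)
      (hmeas T t).aestronglyMeasurable (ae_of_all _ fun z => ?_)
    rw [Real.norm_of_nonneg (Finset.sum_nonneg fun i _ => sq_nonneg _)]
    exact hK _ _
  induction T with
  | zero =>
    have : ∀ z : Fin 0 → Fin n → ℝ, amplitude z * amplitude (shear s 0 z) = amplitude z ^ 2 :=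
      fun z => by simp [amplitude]
    simp [this, integral_amplitude_sq]
  | succ T ih =>
    -- The noise of the new round integrates out, as the shifts depend on earlier rounds only.
    have hterm : ∀ t ∈ Finset.range (T + 1), ∫ z : Fin (T + 1) → Fin n → ℝ,
        (amplitude z ^ 2 + amplitude (shear s (T + 1) z) ^ 2) * ∑ i, s t (extendZero z) i ^ 2
        = ∫ z : Fin T → Fin n → ℝ,
        (amplitude z ^ 2 + amplitude (shear s T z) ^ 2) * ∑ i, s t (extendZero z) i ^ 2 := by
      intro t ht
      rw [(integral_snoc (hint (T + 1) t)).2]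
      congr 1 with z
      have hst : ∀ y, s t (extendZero (Fin.snoc z y : Fin (T + 1) → Fin n → ℝ))
          = s t (extendZero z) := fun y => hs.causal t _ _ fun j hj =>
        extendZero_snoc z y (hj.trans_le (Nat.lt_succ_iff.1 (Finset.mem_range.1 ht)))
      simp only [shear_snoc hs, amplitude_snoc, mul_pow, hst]
      rw [integral_mul_const, integral_add (integrable_tentProd_sq.const_mul _)
        ((integrable_tentProd_sq.comp_add_right _).const_mul _), integral_const_mul,
        integral_const_mul, integral_tentProd_sq, integral_tentProd_shift_sq, mul_one, mul_one]
    rw [Finset.sum_congr rfl hterm, Finset.sum_range_succ]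
    obtain ⟨hi, he⟩ := integral_snoc (integrable_amplitude_mul_amplitude_shear hs (T + 1))
    have hinner : ∀ z : Fin T → Fin n → ℝ,
        ∫ y, amplitude (Fin.snoc z y : Fin (T + 1) → Fin n → ℝ)
          * amplitude (shear s (T + 1) (Fin.snoc z y))
        = amplitude z * amplitude (shear s T z)
          * ∫ y, tentProd y * tentProd (y + s T (extendZero z)) := by
      intro z
      rw [← integral_const_mul]
      congr 1 with y
      rw [shear_snoc hs, amplitude_snoc, amplitude_snoc]
      ring
    rw [he]
    have hstep : ∫ z : Fin T → Fin n → ℝ, (amplitude z * amplitude (shear s T z)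
          - 3 / 2 * ((amplitude z ^ 2 + amplitude (shear s T z) ^ 2)
            * ∑ i, s T (extendZero z) i ^ 2))
        ≤ ∫ z : Fin T → Fin n → ℝ, ∫ y, amplitude (Fin.snoc z y : Fin (T + 1) → Fin n → ℝ)
          * amplitude (shear s (T + 1) (Fin.snoc z y)) := by
      refine integral_mono ((integrable_amplitude_mul_amplitude_shear hs T).sub
        ((hint T T).const_mul _)) hi fun z => ?_
      simp only [hinner]
      have ha := affinity_tentProd_ge (s T (extendZero z))
      have hp := mul_nonneg (amplitude_nonneg z) (amplitude_nonneg (shear s T z))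
      have hN : 0 ≤ ∑ i, s T (extendZero z) i ^ 2 := Finset.sum_nonneg fun i _ => sq_nonneg _
      have h1 := mul_le_mul_of_nonneg_left ha hp
      have h2 := mul_nonneg (sq_nonneg (amplitude z - amplitude (shear s T z))) hN
      nlinarith
    rw [integral_sub (integrable_amplitude_mul_amplitude_shear hs T) ((hint T T).const_mul _),
      integral_const_mul] at hstep
    linarith

/-- An observable `φ'` of the second world that the shear pulls back to `φ` can be integrated in the
first world, against the sheared density. -/
lemma integral_amplitude_sq_mul_eq_shear (hs : IsPredictable s) {T : ℕ}
    {φ φ' : (Fin T → Fin n → ℝ) → ℝ} (hφ' : Measurable φ') (h : ∀ z, φ' (shear s T z) = φ z) :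
    ∫ z, amplitude z ^ 2 * φ' z = ∫ z, amplitude (shear s T z) ^ 2 * φ z := by
  rw [← (measurePreserving_shear hs T).map_eq, integral_map (measurable_shear hs T).aemeasurable,
    (measurePreserving_shear hs T).map_eq]
  · simp [h]
  · exact ((continuous_amplitude.measurable.pow_const 2).mul hφ').aestronglyMeasurable

/-- Two observables identified by the shear have close means if the affinity is near `1`. With `p`,
`q` the two densities, `|p - q| = |√p - √q| (√p + √q) ≤ 2 (√p - √q) ^ 2 + (√p + √q) ^ 2 / 8`. -/
lemma abs_integral_sub_le (hs : IsPredictable s) {T : ℕ} {B : ℝ}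
    {φ φ' : (Fin T → Fin n → ℝ) → ℝ} (hφ : Measurable φ) (hφ' : Measurable φ')
    (hB : ∀ z, |φ z| ≤ B) (h : ∀ z, φ' (shear s T z) = φ z) :
    |(∫ z, amplitude z ^ 2 * φ z) - ∫ z, amplitude z ^ 2 * φ' z| ≤
      B * (1 / 2 + 4 * (1 - ∫ z, amplitude z * amplitude (shear s T z))) := by
  have e1 := integral_amplitude_sq_mul_eq_shear hs hφ' h
  have hsq := integrable_amplitude_sq (n := n) (T := T)
  have hsq' := integrable_amplitude_shear_sq hs T
  have i3 := integrable_amplitude_mul_amplitude_shear hs T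
  have hadd : Integrable fun z : Fin T → Fin n → ℝ => amplitude z ^ 2 + amplitude (shear s T z) ^ 2 :=
    hsq.add hsq'
  have i4 : Integrable fun z : Fin T → Fin n → ℝ =>
      B * ((17 / 8) * (amplitude z ^ 2 + amplitude (shear s T z) ^ 2)
        - 15 / 4 * (amplitude z * amplitude (shear s T z))) :=
    ((hadd.const_mul _).sub (i3.const_mul _)).const_mul B
  have i1 : Integrable fun z => amplitude z ^ 2 * φ z :=
    hsq.mul_bdd (c := B) hφ.aestronglyMeasurable (ae_of_all _ fun z => hB z)
  have i2 : Integrable fun z => amplitude (shear s T z) ^ 2 * φ z :=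
    hsq'.mul_bdd (c := B) hφ.aestronglyMeasurable (ae_of_all _ fun z => hB z)
  rw [e1, ← integral_sub i1 i2]
  have e2 : ∫ z, amplitude (shear s T z) ^ 2 = 1 := by
    have := integral_amplitude_sq_mul_eq_shear hs (T := T) (φ := fun _ => 1) (φ' := fun _ => 1)
      measurable_const fun _ => rfl
    simpa [integral_amplitude_sq] using this.symm
  have e3 : ∫ z : Fin T → Fin n → ℝ, B * ((17 / 8) * (amplitude z ^ 2 + amplitude (shear s T z) ^ 2)
      - 15 / 4 * (amplitude z * amplitude (shear s T z)))
      = B * (17 / 4 - 15 / 4 * ∫ z, amplitude z * amplitude (shear s T z)) := by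
    rw [integral_const_mul, integral_sub (hadd.const_mul _) (i3.const_mul _),
      integral_const_mul, integral_const_mul]
    rw [integral_add hsq hsq', integral_amplitude_sq, e2]
    ring
  have hB0 : 0 ≤ B := (abs_nonneg _).trans (hB 0)
  have hA : ∫ z, amplitude z * amplitude (shear s T z) ≤ 1 := by
    have := integral_mono (f := fun z => amplitude z * amplitude (shear s T z)) i3
      (hadd.const_mul (1 / 2)) fun z => by
        show amplitude z * amplitude (shear s T z) ≤
          1 / 2 * (amplitude z ^ 2 + amplitude (shear s T z) ^ 2)
        nlinarith [sq_nonneg (amplitude z - amplitude (shear s T z))]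
    rw [integral_const_mul] at this
    rw [integral_add hsq hsq', integral_amplitude_sq, e2] at this
    linarith
  calc |∫ z, (amplitude z ^ 2 * φ z - amplitude (shear s T z) ^ 2 * φ z)|
      ≤ ∫ z : Fin T → Fin n → ℝ, B * ((17 / 8) * (amplitude z ^ 2 + amplitude (shear s T z) ^ 2)
      - 15 / 4 * (amplitude z * amplitude (shear s T z))) := by
        rw [← Real.norm_eq_abs]
        refine norm_integral_le_of_norm_le i4 (ae_of_all _ fun z => ?_)
        set a := amplitude z
        set b := amplitude (shear s T z)
        have hab : |a ^ 2 - b ^ 2| ≤ 17 / 8 * (a ^ 2 + b ^ 2) - 15 / 4 * (a * b) := by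
          rw [abs_le]
          constructor <;> nlinarith [sq_nonneg (4 * (a - b) - (a + b)),
            sq_nonneg (4 * (a - b) + (a + b))]
        rw [← sub_mul, Real.norm_eq_abs, abs_mul, mul_comm]
        exact mul_le_mul (hB z) hab (abs_nonneg _) hB0
    _ = B * (17 / 4 - 15 / 4 * ∫ z, amplitude z * amplitude (shear s T z)) := e3
    _ ≤ _ := by
        gcongr
        linarith

end

/-! ### Mean-zero noise and projections onto two directions -/

section

variable {n : ℕ}

/-- The noise of round `t` is uncorrelated with predictable quantities, as the law is invariant under
changing its sign. -/
lemma integral_amplitude_sq_mul_noise_eq_zero {φ : ℕ → (ℕ → Fin n → ℝ) → ℝ} (hφ : IsPredictable φ)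
    (T t : ℕ) (i : Fin n) :
    ∫ z : Fin T → Fin n → ℝ, amplitude z ^ 2 * (extendZero z t i * φ t (extendZero z)) = 0 := by
  rcases le_or_gt T t with ht | ht
  · simp [extendZero_of_le _ ht]
  -- Reflecting the noise of round `t` preserves everything but the sign of the integrand.
  let f : Fin T → (Fin n → ℝ) → (Fin n → ℝ) := fun j y => if (j : ℕ) = t then -y else y
  have hf : ∀ j, MeasurePreserving (f j) volume volume := fun j => by
    by_cases h : (j : ℕ) = t
    · simpa [f, h] using Measure.measurePreserving_neg (volume : Measure (Fin n → ℝ))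
    · simp only [f, h, if_false]
      exact MeasurePreserving.id (volume : Measure (Fin n → ℝ))
  have hR : MeasurePreserving (fun z : Fin T → Fin n → ℝ => fun j => f j (z j)) volume volume :=
    volume_preserving_pi hf
  have hdens : ∀ z : Fin T → Fin n → ℝ, amplitude (fun j => f j (z j)) = amplitude z := fun z => by
    refine Finset.prod_congr rfl fun j _ => ?_
    by_cases h : (j : ℕ) = t <;> simp [f, h, tentProd_neg]
  have hφz : ∀ z : Fin T → Fin n → ℝ,
      φ t (extendZero fun j => f j (z j)) = φ t (extendZero z) := fun z => by
    refine hφ.causal t _ _ fun j hj => ?_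
    rw [extendZero_of_lt _ (hj.trans ht), extendZero_of_lt _ (hj.trans ht)]
    simp [f, hj.ne]
  have hz : ∀ z : Fin T → Fin n → ℝ,
      extendZero (fun j => f j (z j)) t i = -extendZero z t i := fun z => by
    rw [extendZero_of_lt _ ht, extendZero_of_lt _ ht]
    simp [f]
  have hmeas : Measurable fun z : Fin T → Fin n → ℝ =>
      amplitude z ^ 2 * (extendZero z t i * φ t (extendZero z)) := by
    have h1 := (hφ.measurable t).comp (measurable_extendZero (n := n) (T := T))
    have h2 : Measurable fun z : Fin T → Fin n → ℝ => extendZero z t i :=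
      (measurable_pi_apply i).comp ((measurable_pi_apply t).comp measurable_extendZero)
    exact (continuous_amplitude.measurable.pow_const 2).mul (h2.mul h1)
  have key : ∫ z : Fin T → Fin n → ℝ, amplitude z ^ 2 * (extendZero z t i * φ t (extendZero z))
      = ∫ z : Fin T → Fin n → ℝ, -(amplitude z ^ 2 * (extendZero z t i * φ t (extendZero z))) := by
    conv_lhs => rw [← hR.map_eq, integral_map hR.measurable.aemeasurable
      hmeas.aestronglyMeasurable]
    congr 1 with z
    rw [hdens, hφz, hz]
    ring
  rw [integral_neg] at key
  linarith

/-- The orthogonal projection of the `i`-th basis vector onto the span of `a` and `b`, written out by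
the Gram-Schmidt process so that it is visibly measurable in `a` and `b`. If `a` or the second vector
of the process vanishes, division by zero makes its term vanish, as it should. -/
def projSpan (a b : Fin n → ℝ) (i : Fin n) : Fin n → ℝ :=
  let c := b - (b ⬝ᵥ a / a ⬝ᵥ a) • a
  (a i / a ⬝ᵥ a) • a + (c i / c ⬝ᵥ c) • c

lemma dotProduct_gramSchmidt (a b : Fin n → ℝ) :
    (b - (b ⬝ᵥ a / a ⬝ᵥ a) • a) ⬝ᵥ a = 0 := by
  rcases eq_or_ne a 0 with rfl | ha
  · simp
  · have : a ⬝ᵥ a ≠ 0 := fun h => ha (dotProduct_self_eq_zero.1 h)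
    rw [sub_dotProduct, smul_dotProduct, smul_eq_mul, div_mul_cancel₀ _ this, sub_self]

lemma div_dotProduct_self_mul (a : Fin n → ℝ) (i : Fin n) : a i / a ⬝ᵥ a * a ⬝ᵥ a = a i := by
  rcases eq_or_ne a 0 with rfl | ha
  · simp
  · exact div_mul_cancel₀ _ fun h => ha (dotProduct_self_eq_zero.1 h)

lemma projSpan_dotProduct_left (a b : Fin n → ℝ) (i : Fin n) : projSpan a b i ⬝ᵥ a = a i := by
  simp only [projSpan, add_dotProduct, smul_dotProduct, dotProduct_gramSchmidt, smul_eq_mul,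
    mul_zero, add_zero, div_dotProduct_self_mul]

lemma projSpan_dotProduct_right (a b : Fin n → ℝ) (i : Fin n) : projSpan a b i ⬝ᵥ b = b i := by
  have h : projSpan a b i ⬝ᵥ (b - (b ⬝ᵥ a / a ⬝ᵥ a) • a) = (b - (b ⬝ᵥ a / a ⬝ᵥ a) • a) i := by
    simp only [projSpan, add_dotProduct, smul_dotProduct, smul_eq_mul, div_dotProduct_self_mul,
      dotProduct_comm a (b - _), dotProduct_gramSchmidt, mul_zero, zero_add]
  rw [dotProduct_sub, dotProduct_smul, projSpan_dotProduct_left] at h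
  simpa using h

lemma sum_sq_div_dotProduct_self_le (a : Fin n → ℝ) :
    ∑ i, a i / a ⬝ᵥ a * a i ≤ 1 := by
  have : ∑ i, a i / a ⬝ᵥ a * a i = a ⬝ᵥ a / a ⬝ᵥ a := by
    simp only [dotProduct, Finset.sum_div]
    exact Finset.sum_congr rfl fun i _ => by ring
  rw [this]
  exact div_self_le_one _

lemma sum_sq_projSpan (a b : Fin n → ℝ) (i : Fin n) :
    ∑ j, projSpan a b i j ^ 2 = a i / a ⬝ᵥ a * a i +
      (b - (b ⬝ᵥ a / a ⬝ᵥ a) • a) i / (b - (b ⬝ᵥ a / a ⬝ᵥ a) • a) ⬝ᵥ (b - (b ⬝ᵥ a / a ⬝ᵥ a) • a)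
        * (b - (b ⬝ᵥ a / a ⬝ᵥ a) • a) i := by
  have h : ∑ j, projSpan a b i j ^ 2 = projSpan a b i ⬝ᵥ projSpan a b i := by
    simp [dotProduct, sq]
  have hc : projSpan a b i ⬝ᵥ (b - (b ⬝ᵥ a / a ⬝ᵥ a) • a) = (b - (b ⬝ᵥ a / a ⬝ᵥ a) • a) i := by
    rw [dotProduct_sub, dotProduct_smul, projSpan_dotProduct_left, projSpan_dotProduct_right]
    simp
  rw [h]
  nth_rw 2 [projSpan]
  rw [dotProduct_add, dotProduct_smul, dotProduct_smul, projSpan_dotProduct_left, hc]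
  simp only [smul_eq_mul]

/-- The trace of a projection of rank at most two. -/
lemma sum_sum_sq_projSpan_le (a b : Fin n → ℝ) : ∑ i, ∑ j, projSpan a b i j ^ 2 ≤ 2 := by
  simp only [sum_sq_projSpan, Finset.sum_add_distrib]
  linarith [sum_sq_div_dotProduct_self_le a,
    sum_sq_div_dotProduct_self_le (b - (b ⬝ᵥ a / a ⬝ᵥ a) • a)]

lemma sum_sq_projSpan_le (a b : Fin n → ℝ) (i : Fin n) : ∑ j, projSpan a b i j ^ 2 ≤ 2 :=
  (Finset.single_le_sum (f := fun i => ∑ j, projSpan a b i j ^ 2)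
    (fun _ _ => Finset.sum_nonneg fun _ _ => sq_nonneg _) (Finset.mem_univ i)).trans
    (sum_sum_sq_projSpan_le a b)

lemma measurable_projSpan (i : Fin n) :
    Measurable fun p : (Fin n → ℝ) × (Fin n → ℝ) => projSpan p.1 p.2 i := by
  unfold projSpan dotProduct
  simp only [Pi.sub_apply, Pi.smul_apply]
  fun_prop

end

/-! ### Sign-separated worlds with identical feedback -/

section

variable {n : ℕ}

/-- The coordinates that the losses depend on: all but the first. -/
def tailCoords (x : L1Space (n + 1)) : Fin n → ℝ := fun i => x i.succ

@[fun_prop]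
lemma measurable_tailCoords : Measurable (tailCoords : L1Space (n + 1) → Fin n → ℝ) := by
  unfold tailCoords
  fun_prop

/-- The linear loss of round `t` with noise `ζ t` and drift `-θ t`. -/
def linLoss (κ : ℝ) (θ ζ : ℕ → Fin n → ℝ) (t : ℕ) (x : L1Space (n + 1)) : ℝ :=
  κ * ((ζ t - θ t) ⬝ᵥ tailCoords x)

lemma measurable_linLoss (κ : ℝ) (θ : ℕ → Fin n → ℝ) (t : ℕ) :
    Measurable fun p : (ℕ → Fin n → ℝ) × L1Space (n + 1) => linLoss κ θ p.1 t p.2 := by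
  unfold linLoss dotProduct
  have h : Measurable fun p : (ℕ → Fin n → ℝ) × L1Space (n + 1) => tailCoords p.2 := by fun_prop
  have h1 : Measurable fun p : (ℕ → Fin n → ℝ) × L1Space (n + 1) => p.1 t := by fun_prop
  refine (Finset.measurable_sum _ fun i _ => ?_).const_mul κ
  exact (((measurable_pi_apply i).comp h1).sub_const _).mul ((measurable_pi_apply i).comp h)

variable {X : Set (L1Space (n + 1))} {Ω : Type*} [MeasurableSpace Ω]

namespace TwoPointAlgorithm

lemma feedback_congr (A : TwoPointAlgorithm (n + 1) X Ω) {f f' : ℕ → L1Space (n + 1) → ℝ} (ω : Ω)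
    {t : ℕ} (h : ∀ s < t, f s = f' s) : A.feedback f ω t = A.feedback f' ω t := by
  induction t with
  | zero => rfl
  | succ t ih =>
    simp only [feedback]
    rw [ih fun s hs => h s (hs.trans t.lt_succ_self), h t t.lt_succ_self]

lemma measurable_feedback (A : TwoPointAlgorithm (n + 1) X Ω) (κ : ℝ) (θ : ℕ → Fin n → ℝ) (t : ℕ) :
    Measurable fun p : Ω × (ℕ → Fin n → ℝ) => A.feedback (linLoss κ θ p.2) p.1 t := by
  induction t with
  | zero => exact measurable_const
  | succ t ih =>
    have hp : Measurable fun p : Ω × (ℕ → Fin n → ℝ) =>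
        A.play t p.1 (A.feedback (linLoss κ θ p.2) p.1 t) :=
      (A.measurable_play t).comp (measurable_fst.prodMk ih)
    have h1 := (measurable_linLoss κ θ t).comp (measurable_snd.prodMk hp.fst)
    have h2 := (measurable_linLoss κ θ t).comp (measurable_snd.prodMk hp.snd)
    refine measurable_pi_iff.2 fun j => ?_
    refine Fin.lastCases ?_ (fun j => ?_) j
    · simp only [feedback, Fin.snoc_last]
      exact h1.prodMk h2
    · simp only [feedback, Fin.snoc_castSucc]
      exact (measurable_pi_apply j).comp ih

lemma measurable_output (A : TwoPointAlgorithm (n + 1) X Ω) (κ : ℝ) (θ : ℕ → Fin n → ℝ) (t : ℕ) :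
    Measurable fun p : Ω × (ℕ → Fin n → ℝ) => A.output (linLoss κ θ p.2) t p.1 :=
  (A.measurable_play t).comp (measurable_fst.prodMk (A.measurable_feedback κ θ t))

lemma isPredictable_output (A : TwoPointAlgorithm (n + 1) X Ω) (κ : ℝ) (θ : ℕ → Fin n → ℝ)
    (ω : Ω) : IsPredictable fun t ζ => A.output (linLoss κ θ ζ) t ω where
  measurable t := (A.measurable_output κ θ t).comp (measurable_const.prodMk measurable_id)
  causal t ζ ζ' h := by
    have : ∀ s < t, linLoss κ θ ζ s = linLoss κ θ ζ' s := fun s hs => by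
      ext x; simp [linLoss, h s hs]
    simp only [output, A.feedback_congr ω this]

/-- Coordinate `i + 1` of the mean of the two points played in round `t`. -/
def midpoint (A : TwoPointAlgorithm (n + 1) X Ω) (κ : ℝ) (θ : ℕ → Fin n → ℝ) (ω : Ω) (i : Fin n)
    (t : ℕ) (ζ : ℕ → Fin n → ℝ) : ℝ :=
  ((A.output (linLoss κ θ ζ) t ω).1 i.succ + (A.output (linLoss κ θ ζ) t ω).2 i.succ) / 2

/-- The projection of the `i`-th basis vector onto the span of the two points played in round `t`,
which measures what this round reveals about the coordinate `i`. -/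
def probe (A : TwoPointAlgorithm (n + 1) X Ω) (κ : ℝ) (θ : ℕ → Fin n → ℝ) (ω : Ω) (i : Fin n)
    (t : ℕ) (ζ : ℕ → Fin n → ℝ) : Fin n → ℝ :=
  projSpan (tailCoords (A.output (linLoss κ θ ζ) t ω).1)
    (tailCoords (A.output (linLoss κ θ ζ) t ω).2) i

end TwoPointAlgorithm

lemma IsPredictable.comp {β γ : Type*} [MeasurableSpace β] [MeasurableSpace γ]
    {s : ℕ → (ℕ → Fin n → ℝ) → β} (hs : IsPredictable s) {g : ℕ → β → γ}
    (hg : ∀ t, Measurable (g t)) : IsPredictable fun t ζ => g t (s t ζ) where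
  measurable t := (hg t).comp (hs.measurable t)
  causal t ζ ζ' h := by simp only [hs.causal t ζ ζ' h]

namespace TwoPointAlgorithm

variable (A : TwoPointAlgorithm (n + 1) X Ω) (κ : ℝ) (θ : ℕ → Fin n → ℝ) (ω : Ω)

lemma isPredictable_midpoint (i : Fin n) : IsPredictable (A.midpoint κ θ ω i) :=
  (A.isPredictable_output κ θ ω).comp
    (g := fun _ (p : L1Space (n + 1) × L1Space (n + 1)) => (p.1 i.succ + p.2 i.succ) / 2)
    fun _ => by fun_prop

lemma isPredictable_probe (i : Fin n) : IsPredictable (A.probe κ θ ω i) :=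
  (A.isPredictable_output κ θ ω).comp
    (g := fun _ (p : L1Space (n + 1) × L1Space (n + 1)) =>
      projSpan (tailCoords p.1) (tailCoords p.2) i)
    fun _ => (measurable_projSpan i).comp
      ((measurable_tailCoords.comp measurable_fst).prodMk (measurable_tailCoords.comp measurable_snd))

lemma abs_midpoint_le {b : ℝ} (hX : ∀ x ∈ X, ∀ i : Fin n, |x i.succ| ≤ b) (i : Fin n) (t : ℕ)
    (ζ : ℕ → Fin n → ℝ) : |A.midpoint κ θ ω i t ζ| ≤ b := by
  have h1 := abs_le.1 (hX _ (A.fst_mem t ω (A.feedback (linLoss κ θ ζ) ω t)) i)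
  have h2 := abs_le.1 (hX _ (A.snd_mem t ω (A.feedback (linLoss κ θ ζ) ω t)) i)
  unfold midpoint output
  rw [abs_le]
  constructor <;> linarith

variable {A κ θ ω}

/-- Changing the drift in the coordinate `i` and shearing the noise along the projections of the
`i`-th basis vector leaves the whole run of the algorithm unchanged. -/
lemma output_shear {θ' : ℕ → Fin n → ℝ} {δ : ℕ → ℝ} {i : Fin n} {T : ℕ}
    (hθ : ∀ t, θ' t = θ t + δ t • Pi.single i 1) (hδ : ∀ t, T ≤ t → δ t = 0)
    (z : Fin T → Fin n → ℝ) (t : ℕ) :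
    A.output (linLoss κ θ'
      (extendZero (shear (fun t ζ => δ t • A.probe κ θ ω i t ζ) T z))) t ω
      = A.output (linLoss κ θ (extendZero z)) t ω := by
  have hloss : ∀ t, ∀ x : L1Space (n + 1),
      A.probe κ θ ω i t (extendZero z) ⬝ᵥ tailCoords x = tailCoords x i →
      linLoss κ θ' (extendZero (shear (fun t ζ => δ t • A.probe κ θ ω i t ζ) T z)) t x
        = linLoss κ θ (extendZero z) t x := by
    intro t x hx
    rcases lt_or_ge t T with ht | ht
    · simp only [linLoss, extendZero_of_lt _ ht, shear, hθ]
      simp only [sub_dotProduct, add_dotProduct, smul_dotProduct, hx, single_one_dotProduct]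
      ring
    · simp [linLoss, extendZero_of_le _ ht, hθ, hδ t ht]
  have hfb : ∀ t, A.feedback (linLoss κ θ'
      (extendZero (shear (fun t ζ => δ t • A.probe κ θ ω i t ζ) T z))) ω t
      = A.feedback (linLoss κ θ (extendZero z)) ω t := by
    intro t
    induction t with
    | zero => rfl
    | succ t ih =>
      simp only [feedback]
      have h1 := hloss t _ (projSpan_dotProduct_left _ _ i)
      have h2 := hloss t _ (projSpan_dotProduct_right _ _ i)
      simp only [output] at h1 h2
      rw [ih, h1, h2]
  simp only [output, hfb t]

/-- The expectation of `φ` over the noise of `T` rounds. -/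
def noiseMean (T : ℕ) (φ : (ℕ → Fin n → ℝ) → ℝ) : ℝ :=
  ∫ z : Fin T → Fin n → ℝ, amplitude z ^ 2 * φ (extendZero z)

/-- The play in the coordinate `i` hardly separates two drifts that differ in this coordinate only. -/
lemma abs_noiseMean_midpoint_sub_le {b : ℝ} (hX : ∀ x ∈ X, ∀ i : Fin n, |x i.succ| ≤ b)
    {θ' : ℕ → Fin n → ℝ} {δ : ℕ → ℝ} {i : Fin n} {T : ℕ} {D : ℝ} (hD : ∀ t, δ t ^ 2 ≤ D)
    (hθ : ∀ t, θ' t = θ t + δ t • Pi.single i 1) (hδ : ∀ t, T ≤ t → δ t = 0) (t : ℕ) :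
    |noiseMean T (A.midpoint κ θ ω i t) - noiseMean T (A.midpoint κ θ' ω i t)| ≤
      b * (1 / 2 + 6 * ∑ τ ∈ Finset.range T, δ τ ^ 2 *
        (noiseMean T (fun ζ => ∑ j, A.probe κ θ ω i τ ζ j ^ 2)
          + noiseMean T (fun ζ => ∑ j, A.probe κ θ' ω i τ ζ j ^ 2))) := by
  set s : ℕ → (ℕ → Fin n → ℝ) → Fin n → ℝ := fun t ζ => δ t • A.probe κ θ ω i t ζ
  have hs : IsPredictable s :=
    (A.isPredictable_probe κ θ ω i).comp (g := fun t w => δ t • w) fun t => by fun_prop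
  have hout : ∀ (z : Fin T → Fin n → ℝ) t, A.output (linLoss κ θ' (extendZero (shear s T z))) t ω
      = A.output (linLoss κ θ (extendZero z)) t ω := output_shear hθ hδ
  have hD0 : 0 ≤ D := (sq_nonneg _).trans (hD 0)
  have hnorm : ∀ t ζ, ∑ j, s t ζ j ^ 2 = δ t ^ 2 * ∑ j, A.probe κ θ ω i t ζ j ^ 2 := fun t ζ => by
    simp [s, mul_pow, Finset.mul_sum]
  have hK : ∀ t ζ, ∑ j, s t ζ j ^ 2 ≤ D * 2 := fun t ζ => by
    rw [hnorm]
    exact mul_le_mul (hD t) (sum_sq_projSpan_le _ _ i) (Finset.sum_nonneg fun _ _ => sq_nonneg _) hD0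
  have hb : 0 ≤ b := (abs_nonneg _).trans (A.abs_midpoint_le κ θ ω hX i 0 0)
  have h1 := abs_integral_sub_le hs (T := T)
    (φ := fun z => A.midpoint κ θ ω i t (extendZero z))
    (φ' := fun z => A.midpoint κ θ' ω i t (extendZero z))
    (((A.isPredictable_midpoint κ θ ω i).measurable t).comp measurable_extendZero)
    (((A.isPredictable_midpoint κ θ' ω i).measurable t).comp measurable_extendZero)
    (fun z => A.abs_midpoint_le κ θ ω hX i t _)
    (fun z => by simp only [midpoint, hout z t])
  refine h1.trans (mul_le_mul_of_nonneg_left ?_ hb)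
  have h2 := hellinger_shear_le hs hK T
  have h3 : ∀ τ, ∫ z : Fin T → Fin n → ℝ,
      (amplitude z ^ 2 + amplitude (shear s T z) ^ 2) * ∑ j, s τ (extendZero z) j ^ 2
      = δ τ ^ 2 * (noiseMean T (fun ζ => ∑ j, A.probe κ θ ω i τ ζ j ^ 2)
          + noiseMean T (fun ζ => ∑ j, A.probe κ θ' ω i τ ζ j ^ 2)) := by
    intro τ
    have hm : ∀ θ : ℕ → Fin n → ℝ, Measurable fun z : Fin T → Fin n → ℝ =>
        ∑ j, A.probe κ θ ω i τ (extendZero z) j ^ 2 := fun θ => by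
      have := ((A.isPredictable_probe κ θ ω i).measurable τ).comp
        (measurable_extendZero (n := n) (T := T))
      exact Finset.measurable_sum _ fun j _ => ((measurable_pi_apply j).comp this).pow_const 2
    have hbd : ∀ z : Fin T → Fin n → ℝ,
        ‖∑ j, A.probe κ θ ω i τ (extendZero z) j ^ 2‖ ≤ 2 := fun z => by
      rw [Real.norm_of_nonneg (Finset.sum_nonneg fun _ _ => sq_nonneg _)]
      exact sum_sq_projSpan_le _ _ i
    have e1 : noiseMean T (fun ζ => ∑ j, A.probe κ θ' ω i τ ζ j ^ 2)
        = ∫ z : Fin T → Fin n → ℝ,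
          amplitude (shear s T z) ^ 2 * ∑ j, A.probe κ θ ω i τ (extendZero z) j ^ 2 :=
      integral_amplitude_sq_mul_eq_shear hs (hm θ') fun z => by simp only [probe, hout z τ]
    rw [e1, noiseMean, ← integral_add, ← integral_const_mul]
    · congr 1 with z
      rw [hnorm]
      ring
    · exact integrable_amplitude_sq.mul_bdd (hm θ).aestronglyMeasurable (ae_of_all _ hbd)
    · exact (integrable_amplitude_shear_sq hs T).mul_bdd (hm θ).aestronglyMeasurable (ae_of_all _ hbd)
  simp only [h3] at h2
  linarith

end TwoPointAlgorithm

end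

/-! ### Expected regret against linear losses -/

section

variable {n : ℕ}

lemma abs_extendZero_le_one {T : ℕ} {z : Fin T → Fin n → ℝ} (hz : amplitude z ≠ 0) (t : ℕ)
    (i : Fin n) : |extendZero z t i| ≤ 1 := by
  rcases lt_or_ge t T with ht | ht
  · rw [extendZero_of_lt _ ht]
    exact abs_le_one_of_tentProd_ne_zero (Finset.prod_ne_zero_iff.1 hz _ (Finset.mem_univ _)) i
  · simp [extendZero_of_le _ ht]

lemma integrable_amplitude_sq_mul {T : ℕ} {ψ : (Fin T → Fin n → ℝ) → ℝ} (hψ : Measurable ψ) {C : ℝ}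
    (hC : ∀ z, amplitude z ≠ 0 → |ψ z| ≤ C) : Integrable fun z => amplitude z ^ 2 * ψ z := by
  refine (integrable_amplitude_sq.mul_const C).mono'
    ((continuous_amplitude.measurable.pow_const 2).mul hψ).aestronglyMeasurable
    (ae_of_all _ fun z => ?_)
  rw [Real.norm_eq_abs, abs_mul, abs_of_nonneg (sq_nonneg _)]
  rcases eq_or_ne (amplitude z) 0 with h | h
  · simp [h]
  · exact mul_le_mul_of_nonneg_left (hC z h) (sq_nonneg _)

/-- The first moment method for the noise law, with a point of its support. -/
lemma exists_amplitude_ne_zero_le {T : ℕ} {ψ : (Fin T → Fin n → ℝ) → ℝ} {B : ℝ}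
    (hψ : Integrable fun z => amplitude z ^ 2 * ψ z) (hB : B ≤ ∫ z, amplitude z ^ 2 * ψ z) :
    ∃ z, amplitude z ≠ 0 ∧ B ≤ ψ z := by
  by_contra! h
  have hi : Integrable fun z : Fin T → Fin n → ℝ => amplitude z ^ 2 * B - amplitude z ^ 2 * ψ z :=
    (integrable_amplitude_sq.mul_const B).sub hψ
  have hnn : ∀ z : Fin T → Fin n → ℝ, 0 ≤ amplitude z ^ 2 * B - amplitude z ^ 2 * ψ z := fun z => by
    rcases eq_or_ne (amplitude z) 0 with h0 | h0
    · simp [h0]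
    · rw [← mul_sub]
      exact mul_nonneg (sq_nonneg _) (sub_nonneg.2 (h z h0).le)
  have h0 : ∫ z : Fin T → Fin n → ℝ, (amplitude z ^ 2 * B - amplitude z ^ 2 * ψ z) = 0 := by
    refine le_antisymm ?_ (integral_nonneg hnn)
    rw [integral_sub (integrable_amplitude_sq.mul_const B) hψ, integral_mul_const,
      integral_amplitude_sq]
    linarith
  have hae := (integral_eq_zero_iff_of_nonneg hnn hi).1 h0
  have hd : (fun z : Fin T → Fin n → ℝ => amplitude z ^ 2) =ᵐ[volume] 0 := by
    filter_upwards [hae] with z hz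
    by_contra hne
    have hne' : amplitude z ≠ 0 := fun h' => hne (by simp [h'])
    have : 0 < amplitude z ^ 2 * (B - ψ z) := by
      have := h z hne'
      exact mul_pos (by positivity) (by linarith)
    rw [mul_sub] at this
    exact this.ne' hz
  have := integral_congr_ae hd
  simp [integral_amplitude_sq] at this

namespace TwoPointAlgorithm
variable {X : Set (L1Space (n + 1))} {Ω : Type*} [MeasurableSpace Ω]
  (A : TwoPointAlgorithm (n + 1) X Ω) (κ : ℝ) (θ : ℕ → Fin n → ℝ) (ω : Ω)

lemma dynamicRegret_linLoss (T : ℕ) (ζ : ℕ → Fin n → ℝ) (u : ℕ → L1Space (n + 1)) :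
    A.dynamicRegret T (linLoss κ θ ζ) u ω = ∑ t ∈ Finset.range T, ∑ i,
      (κ * (ζ t i * (A.midpoint κ θ ω i t ζ - u t i.succ))
        + κ * θ t i * (u t i.succ - A.midpoint κ θ ω i t ζ)) := by
  rw [dynamicRegret, ← Finset.sum_sub_distrib]
  refine Finset.sum_congr rfl fun t _ => ?_
  simp only [linLoss, dotProduct, midpoint, tailCoords, Pi.sub_apply]
  rw [← mul_add, ← Finset.sum_add_distrib, mul_div_assoc, Finset.sum_div, ← mul_sub,
    ← Finset.sum_sub_distrib, Finset.mul_sum]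
  exact Finset.sum_congr rfl fun i _ => by ring

variable {A κ θ ω}

lemma abs_dynamicRegret_le {b : ℝ} (hX : ∀ x ∈ X, ∀ i : Fin n, |x i.succ| ≤ b) (hκ : 0 ≤ κ)
    (hθ : ∀ t i, |θ t i| ≤ 1) {T : ℕ} {u : ℕ → L1Space (n + 1)}
    (hu : ∀ t, ∀ i : Fin n, |u t i.succ| ≤ b) {ζ : ℕ → Fin n → ℝ} (hζ : ∀ t i, |ζ t i| ≤ 1) :
    |A.dynamicRegret T (linLoss κ θ ζ) u ω| ≤ T * (n * (κ * (4 * b))) := by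
  rw [dynamicRegret_linLoss]
  have hterm : ∀ t i, |κ * (ζ t i * (A.midpoint κ θ ω i t ζ - u t i.succ))
        + κ * θ t i * (u t i.succ - A.midpoint κ θ ω i t ζ)| ≤ κ * (4 * b) := fun t i => by
    have h1 := A.abs_midpoint_le κ θ ω hX i t ζ
    rw [show κ * (ζ t i * (A.midpoint κ θ ω i t ζ - u t i.succ))
        + κ * θ t i * (u t i.succ - A.midpoint κ θ ω i t ζ)
        = κ * ((ζ t i - θ t i) * (A.midpoint κ θ ω i t ζ - u t i.succ)) by ring, abs_mul, abs_mul,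
      abs_of_nonneg hκ]
    have h2 : |ζ t i - θ t i| ≤ 2 := (abs_sub _ _).trans (by linarith [hζ t i, hθ t i])
    have h3 : |A.midpoint κ θ ω i t ζ - u t i.succ| ≤ 2 * b :=
      (abs_sub _ _).trans (by linarith [hu t i])
    have := mul_le_mul h2 h3 (abs_nonneg _) (by norm_num)
    exact mul_le_mul_of_nonneg_left (by linarith) hκ
  refine (Finset.abs_sum_le_sum_abs _ _).trans ?_
  refine (Finset.sum_le_card_nsmul _ _ (n * (κ * (4 * b))) fun t _ => ?_).trans (by simp)
  refine (Finset.abs_sum_le_sum_abs _ _).trans ?_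
  exact (Finset.sum_le_card_nsmul _ _ (κ * (4 * b)) fun i _ => hterm t i).trans (by simp)

lemma noiseMean_dynamicRegret {b : ℝ} (hX : ∀ x ∈ X, ∀ i : Fin n, |x i.succ| ≤ b)
    (T' T : ℕ) (u : ℕ → L1Space (n + 1)) :
    noiseMean T' (fun ζ => A.dynamicRegret T (linLoss κ θ ζ) u ω) = ∑ t ∈ Finset.range T, ∑ i,
      κ * θ t i * (u t i.succ - noiseMean T' (A.midpoint κ θ ω i t)) := by
  have hm : ∀ t i, Measurable fun z : Fin T' → Fin n → ℝ =>
      A.midpoint κ θ ω i t (extendZero z) := fun t i =>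
    ((A.isPredictable_midpoint κ θ ω i).measurable t).comp measurable_extendZero
  have hz : ∀ t i, Measurable fun z : Fin T' → Fin n → ℝ => extendZero z t i := fun t i =>
    (measurable_pi_apply i).comp ((measurable_pi_apply t).comp measurable_extendZero)
  have hbd : ∀ t i (z : Fin T' → Fin n → ℝ),
      |A.midpoint κ θ ω i t (extendZero z) - u t i.succ| ≤ b + |u t i.succ| := fun t i z =>
    (abs_sub _ _).trans (by linarith [A.abs_midpoint_le κ θ ω hX i t (extendZero z)])
  have i1 : ∀ t i, Integrable fun z : Fin T' → Fin n → ℝ =>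
      amplitude z ^ 2 * (extendZero z t i * (A.midpoint κ θ ω i t (extendZero z) - u t i.succ)) :=
    fun t i => integrable_amplitude_sq_mul (C := b + |u t i.succ|)
      ((hz t i).mul ((hm t i).sub_const _)) fun z hd => by
        rw [abs_mul]
        calc _ ≤ 1 * (b + |u t i.succ|) :=
              mul_le_mul (abs_extendZero_le_one hd t i) (hbd t i z) (abs_nonneg _) zero_le_one
          _ = _ := one_mul _
  have i2 : ∀ t i, Integrable fun z : Fin T' → Fin n → ℝ =>
      amplitude z ^ 2 * A.midpoint κ θ ω i t (extendZero z) := fun t i =>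
    integrable_amplitude_sq_mul (hm t i) fun z _ => A.abs_midpoint_le κ θ ω hX i t _
  have i4 : ∀ t i, Integrable fun z : Fin T' → Fin n → ℝ =>
      amplitude z ^ 2 * u t i.succ - amplitude z ^ 2 * A.midpoint κ θ ω i t (extendZero z) :=
    fun t i => (integrable_amplitude_sq.mul_const _).sub (i2 t i)
  have i3 : ∀ t i, Integrable fun z : Fin T' → Fin n → ℝ =>
      κ * (amplitude z ^ 2 * (extendZero z t i
        * (A.midpoint κ θ ω i t (extendZero z) - u t i.succ)))
      + κ * θ t i * (amplitude z ^ 2 * u t i.succ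
        - amplitude z ^ 2 * A.midpoint κ θ ω i t (extendZero z)) := fun t i =>
    ((i1 t i).const_mul _).add ((i4 t i).const_mul _)
  have e : ∀ z : Fin T' → Fin n → ℝ,
      amplitude z ^ 2 * A.dynamicRegret T (linLoss κ θ (extendZero z)) u ω
      = ∑ t ∈ Finset.range T, ∑ i, (κ * (amplitude z ^ 2 * (extendZero z t i
        * (A.midpoint κ θ ω i t (extendZero z) - u t i.succ)))
      + κ * θ t i * (amplitude z ^ 2 * u t i.succ
        - amplitude z ^ 2 * A.midpoint κ θ ω i t (extendZero z))) := fun z => by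
    rw [dynamicRegret_linLoss, Finset.mul_sum]
    refine Finset.sum_congr rfl fun t _ => ?_
    rw [Finset.mul_sum]
    exact Finset.sum_congr rfl fun i _ => by ring
  rw [noiseMean]
  simp only [e]
  rw [integral_finsetSum _ fun t _ => integrable_finsetSum _ fun i _ => i3 t i]
  refine Finset.sum_congr rfl fun t _ => ?_
  rw [integral_finsetSum _ fun i _ => i3 t i]
  refine Finset.sum_congr rfl fun i _ => ?_
  have h0 := integral_amplitude_sq_mul_noise_eq_zero
    ((A.isPredictable_midpoint κ θ ω i).comp (g := fun t r => r - u t i.succ) fun t => by fun_prop)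
    T' t i
  rw [integral_add ((i1 t i).const_mul _) ((i4 t i).const_mul _), integral_const_mul,
    integral_const_mul, integral_sub (integrable_amplitude_sq.mul_const _) (i2 t i),
    integral_mul_const, integral_amplitude_sq, h0, noiseMean]
  ring

lemma measurable_dynamicRegret (A : TwoPointAlgorithm (n + 1) X Ω) (κ : ℝ) (θ : ℕ → Fin n → ℝ)
    (T : ℕ) (u : ℕ → L1Space (n + 1)) :
    Measurable fun p : Ω × (ℕ → Fin n → ℝ) => A.dynamicRegret T (linLoss κ θ p.2) u p.1 := by
  simp only [dynamicRegret_linLoss]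
  have hζ : ∀ t i, Measurable fun p : Ω × (ℕ → Fin n → ℝ) => p.2 t i := fun t i => by fun_prop
  have hmid : ∀ t i, Measurable fun p : Ω × (ℕ → Fin n → ℝ) => A.midpoint κ θ p.1 i t p.2 :=
    fun t i => by
      have h := A.measurable_output κ θ t
      have h1 : Measurable fun q : L1Space (n + 1) × L1Space (n + 1) =>
        (q.1 i.succ + q.2 i.succ) / 2 := by fun_prop
      exact h1.comp h
  refine Finset.measurable_sum _ fun t _ => Finset.measurable_sum _ fun i _ => ?_
  exact (((hζ t i).mul ((hmid t i).sub_const _)).const_mul _).add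
    (((hmid t i).const_sub _).const_mul _)

end TwoPointAlgorithm

end

/-! ### Averaging over the signs of a block design -/

section

variable {n m L : ℕ}

/-- The sign of coordinate `i` in round `t` when the rounds are cut into `m` blocks of length `L` with
signs `V`, and `0` after the last block. -/
def blockSign (L : ℕ) (V : Fin m × Fin n → Bool) (t : ℕ) (i : Fin n) : ℝ :=
  if h : t / L < m then (if V (⟨t / L, h⟩, i) then 1 else -1) else 0

lemma abs_blockSign_le (V : Fin m × Fin n → Bool) (t : ℕ) (i : Fin n) :
    |blockSign L V t i| ≤ 1 := by
  unfold blockSign; split_ifs <;> simp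

lemma abs_blockSign (V : Fin m × Fin n → Bool) {t : ℕ} (ht : t / L < m) (i : Fin n) :
    |blockSign L V t i| = 1 := by
  unfold blockSign; rw [dif_pos ht]; split_ifs <;> simp

/-- The change of one sign of a sign pattern. -/
def flipSign (k : Fin m × Fin n) : Equiv.Perm (Fin m × Fin n → Bool) :=
  Function.Involutive.toPerm (fun V => Function.update V k (!V k)) fun V => by simp

lemma flipSign_apply (k : Fin m × Fin n) (V : Fin m × Fin n → Bool) :
    flipSign k V = Function.update V k (!V k) := rfl

lemma blockSign_flipSign (V : Fin m × Fin n → Bool) (b : Fin m) (i : Fin n) (t : ℕ) :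
    blockSign L (flipSign (b, i) V) t = blockSign L V t
      + (if t / L = b then -2 * blockSign L V t i else 0) • Pi.single i 1 := by
  ext j
  by_cases hb : t / L = b
  · have hlt : t / L < m := hb ▸ b.2
    have hb' : (⟨t / L, hlt⟩ : Fin m) = b := Fin.ext hb
    rcases eq_or_ne j i with rfl | hj
    · simp only [blockSign, dif_pos hlt, hb', flipSign_apply, Function.update_self, if_pos hb,
        Pi.add_apply, Pi.smul_apply, Pi.single_eq_same, smul_eq_mul]
      cases V (b, j) <;> norm_num
    · simp only [Pi.add_apply, Pi.smul_apply, Pi.single_eq_of_ne hj, smul_zero, add_zero]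
      simp [blockSign, dif_pos hlt, hb', flipSign_apply, hj]
  · by_cases hlt : t / L < m
    · have hb' : (⟨t / L, hlt⟩ : Fin m) ≠ b := fun h => hb (congrArg Fin.val h)
      simp [blockSign, hlt, hb, flipSign_apply, hb']
    · simp [blockSign, hlt, hb]

namespace TwoPointAlgorithm
variable {X : Set (L1Space (n + 1))} {Ω : Type*} [MeasurableSpace Ω]
  (A : TwoPointAlgorithm (n + 1) X Ω) (κ ε : ℝ) (ω : Ω)

lemma sum_noiseMean_probe_le (θ : ℕ → Fin n → ℝ) (T t : ℕ) :
    ∑ i, noiseMean T (fun ζ => ∑ j, A.probe κ θ ω i t ζ j ^ 2) ≤ 2 := by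
  have hm : ∀ i, Integrable fun z : Fin T → Fin n → ℝ =>
      amplitude z ^ 2 * ∑ j, A.probe κ θ ω i t (extendZero z) j ^ 2 := fun i => by
    have := ((A.isPredictable_probe κ θ ω i).measurable t).comp
      (measurable_extendZero (n := n) (T := T))
    refine integrable_amplitude_sq_mul (C := 2)
      (Finset.measurable_sum _ fun j _ => ((measurable_pi_apply j).comp this).pow_const 2)
      fun _ _ => ?_
    rw [abs_of_nonneg (Finset.sum_nonneg fun _ _ => sq_nonneg _)]
    exact sum_sq_projSpan_le _ _ i
  simp only [noiseMean]
  rw [← integral_finsetSum _ fun i _ => hm i]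
  calc _ ≤ ∫ z : Fin T → Fin n → ℝ, amplitude z ^ 2 * 2 := by
        refine integral_mono (integrable_finsetSum _ fun i _ => hm i)
          (integrable_amplitude_sq.mul_const 2) fun _ => ?_
        simp only [← Finset.mul_sum]
        exact mul_le_mul_of_nonneg_left (sum_sum_sq_projSpan_le _ _) (sq_nonneg _)
    _ = 2 := by rw [integral_mul_const, integral_amplitude_sq, one_mul]

lemma noiseMean_probe_nonneg (θ : ℕ → Fin n → ℝ) (T t : ℕ) (i : Fin n) :
    0 ≤ noiseMean T (fun ζ => ∑ j, A.probe κ θ ω i t ζ j ^ 2) :=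
  integral_nonneg fun _ => mul_nonneg (sq_nonneg _) (Finset.sum_nonneg fun _ _ => sq_nonneg _)

variable {A κ ε ω}

/-- Averaged over the sign patterns, the play is almost uncorrelated with each sign: the patterns are
paired by changing the sign in question. -/
lemma sum_blockSign_mul_noiseMean_le {B : ℝ} (hX : ∀ x ∈ X, ∀ i : Fin n, |x i.succ| ≤ B)
    (hB : 0 ≤ B) (hL : 0 < L) {t : ℕ} (ht : t < m * L) (i : Fin n) :
    ∑ V : Fin m × Fin n → Bool, blockSign L V t i
        * noiseMean (m * L) (A.midpoint κ (ε • blockSign L V) ω i t) ≤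
      ∑ V : Fin m × Fin n → Bool, B * (1 / 4 + 24 * ε ^ 2 *
        ∑ τ ∈ Finset.range (m * L) with τ / L = t / L,
          noiseMean (m * L) (fun ζ => ∑ j, A.probe κ (ε • blockSign L V) ω i τ ζ j ^ 2)) := by
  have hlt : t / L < m := (Nat.div_lt_iff_lt_mul hL).2 ht
  set b : Fin m := ⟨t / L, hlt⟩ with hb
  set M : (Fin m × Fin n → Bool) → ℝ := fun V =>
    noiseMean (m * L) (A.midpoint κ (ε • blockSign L V) ω i t)
  set S : (Fin m × Fin n → Bool) → ℕ → ℝ := fun V τ =>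
    noiseMean (m * L) (fun ζ => ∑ j, A.probe κ (ε • blockSign L V) ω i τ ζ j ^ 2)
  have hS0 : ∀ V τ, 0 ≤ S V τ := fun V τ => A.noiseMean_probe_nonneg κ ω _ _ _ _
  have hflip : ∀ V : Fin m × Fin n → Bool,
      blockSign L (flipSign (b, i) V) t i = -blockSign L V t i := fun V => by
    rw [blockSign_flipSign]
    simp [hb]
    ring
  have hsep : ∀ V : Fin m × Fin n → Bool, |M V - M (flipSign (b, i) V)| ≤
      B * (1 / 2 + 24 * ε ^ 2 * ∑ τ ∈ Finset.range (m * L) with τ / L = t / L,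
        (S V τ + S (flipSign (b, i) V) τ)) := by
    intro V
    have hδ2 : ∀ τ, (if τ / L = t / L then -2 * ε * blockSign L V τ i else 0) ^ 2
        ≤ if τ / L = t / L then 4 * ε ^ 2 else 0 := fun τ => by
      split_ifs
      · have := (sq_le_one_iff_abs_le_one _).2 (abs_blockSign_le (L := L) V τ i)
        nlinarith [sq_nonneg ε]
      · simp
    have h := abs_noiseMean_midpoint_sub_le (A := A) (κ := κ) (ω := ω) hX
      (θ := ε • blockSign L V) (θ' := ε • blockSign L (flipSign (b, i) V)) (i := i) (T := m * L)
      (δ := fun τ => if τ / L = t / L then -2 * ε * blockSign L V τ i else 0)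
      (D := 4 * ε ^ 2) (fun τ => (hδ2 τ).trans (by split_ifs <;> nlinarith [sq_nonneg ε]))
      (fun τ => by
        ext j
        simp only [Pi.smul_apply, blockSign_flipSign, Pi.add_apply, hb, smul_eq_mul]
        split_ifs <;> ring)
      (fun τ hτ => if_neg fun h => by
        have : m ≤ τ / L := (Nat.le_div_iff_mul_le hL).2 hτ
        omega) t
    refine h.trans (mul_le_mul_of_nonneg_left ?_ hB)
    rw [Finset.sum_filter, Finset.mul_sum, Finset.mul_sum]
    refine add_le_add le_rfl (Finset.sum_le_sum fun τ _ => ?_)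
    have := mul_le_mul_of_nonneg_right (hδ2 τ) (add_nonneg (hS0 V τ) (hS0 (flipSign (b, i) V) τ))
    refine (mul_le_mul_of_nonneg_left this (by norm_num : (0 : ℝ) ≤ 6)).trans (le_of_eq ?_)
    split_ifs <;> ring
  have e1 : ∑ V, blockSign L V t i * M V = -∑ V, blockSign L V t i * M (flipSign (b, i) V) := by
    rw [← Equiv.sum_comp (flipSign (b, i)) (fun V => blockSign L V t i * M V),
      ← Finset.sum_neg_distrib]
    exact Finset.sum_congr rfl fun V _ => by rw [hflip]; ring
  -- Only the difference between the two worlds survives, and `hsep` bounds it.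
  have e2 : ∑ V, blockSign L V t i * M V
      = ∑ V, 1 / 2 * (blockSign L V t i * (M V - M (flipSign (b, i) V))) := by
    rw [← Finset.mul_sum]
    simp only [mul_sub, Finset.sum_sub_distrib]
    linarith
  have e3 : ∀ τ, ∑ V, S (flipSign (b, i) V) τ = ∑ V, S V τ := fun τ =>
    Equiv.sum_comp (flipSign (b, i)) fun V => S V τ
  calc ∑ V, blockSign L V t i * M V
      = ∑ V, 1 / 2 * (blockSign L V t i * (M V - M (flipSign (b, i) V))) := e2
    _ ≤ ∑ V, 1 / 2 * (B * (1 / 2 + 24 * ε ^ 2 *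
          ∑ τ ∈ Finset.range (m * L) with τ / L = t / L, (S V τ + S (flipSign (b, i) V) τ))) := by
        refine Finset.sum_le_sum fun V _ => mul_le_mul_of_nonneg_left ?_ (by norm_num)
        refine (le_abs_self _).trans ?_
        rw [abs_mul, abs_blockSign V hlt, one_mul]
        exact hsep V
    _ = _ := by
        simp only [mul_add, Finset.mul_sum, Finset.sum_add_distrib]
        rw [Finset.sum_comm (f := fun V τ => 1 / 2 * (B * (24 * ε ^ 2 * S V τ))),
          Finset.sum_comm (f := fun V τ => 1 / 2 * (B * (24 * ε ^ 2 * S (flipSign (b, i) V) τ))),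
          Finset.sum_comm (f := fun V τ => B * (24 * ε ^ 2 * S V τ))]
        simp only [← Finset.mul_sum, e3]
        simp only [Finset.sum_const, nsmul_eq_mul]
        ring

lemma card_filter_div_eq_le (hL : 0 < L) (N b : ℕ) :
    (Finset.filter (fun τ => τ / L = b) (Finset.range N)).card ≤ L := by
  have : Finset.filter (fun τ => τ / L = b) (Finset.range N) ⊆ Finset.Ico (b * L) (b * L + L) := by
    intro τ hτ
    have h := (Finset.mem_filter.1 hτ).2
    subst h
    rw [Finset.mem_Ico]
    have h1 := Nat.div_add_mod τ L
    have h2 := Nat.mod_lt τ hL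
    have h3 := Nat.mul_comm L (τ / L)
    omega
  simpa using Finset.card_le_card this

lemma sum_signs_noiseMean_regret_ge {B : ℝ} (hX : ∀ x ∈ X, ∀ i : Fin n, |x i.succ| ≤ B)
    (hB : 0 ≤ B) (hκ : 0 ≤ κ) (hε : 0 ≤ ε) (hL : 0 < L) {T : ℕ} (hT : m * L ≤ T)
    (u : (Fin m × Fin n → Bool) → ℕ → L1Space (n + 1))
    (hu : ∀ V, ∀ t < m * L, ∀ i : Fin n, u V t i.succ = B * blockSign L V t i) :
    ∑ _V : Fin m × Fin n → Bool,
        κ * ε * B * (m * L : ℕ) * (3 / 4 * n - 48 * ε ^ 2 * L) ≤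
      ∑ V : Fin m × Fin n → Bool, noiseMean (m * L)
        (fun ζ => A.dynamicRegret T (linLoss κ (ε • blockSign L V) ζ) (u V) ω) := by
  set M : (Fin m × Fin n → Bool) → ℕ → Fin n → ℝ := fun V t i =>
    noiseMean (m * L) (A.midpoint κ (ε • blockSign L V) ω i t)
  set S : (Fin m × Fin n → Bool) → Fin n → ℕ → ℝ := fun V i τ =>
    noiseMean (m * L) (fun ζ => ∑ j, A.probe κ (ε • blockSign L V) ω i τ ζ j ^ 2)
  have hreg : ∀ V : Fin m × Fin n → Bool, noiseMean (m * L)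
        (fun ζ => A.dynamicRegret T (linLoss κ (ε • blockSign L V) ζ) (u V) ω)
      = ∑ t ∈ Finset.range (m * L), ∑ i, κ * ε * (B - blockSign L V t i * M V t i) := by
    intro V
    rw [noiseMean_dynamicRegret hX]
    symm
    refine Finset.sum_subset_zero_on_sdiff (Finset.range_subset_range.2 hT) (fun t ht => ?_)
      fun t ht => ?_
    -- The losses vanish after the last block.
    · have hge : m * L ≤ t := by simpa using (Finset.mem_sdiff.1 ht).2
      have : ¬ t / L < m := not_lt.2 ((Nat.le_div_iff_mul_le hL).2 hge)
      simp [blockSign, this]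
    · have hlt := Finset.mem_range.1 ht
      refine Finset.sum_congr rfl fun i _ => ?_
      have h1 : blockSign L V t i ^ 2 = 1 := by
        rw [← sq_abs, abs_blockSign V ((Nat.div_lt_iff_lt_mul hL).2 hlt), one_pow]
      rw [hu V t hlt]
      simp only [Pi.smul_apply, smul_eq_mul, M]
      linear_combination (-κ * ε * B) * h1
  simp only [hreg]
  rw [Finset.sum_comm]
  have hcell : ∀ t ∈ Finset.range (m * L),
      ∑ _V : Fin m × Fin n → Bool, κ * ε * B * (3 / 4 * n - 48 * ε ^ 2 * L) ≤
      ∑ V : Fin m × Fin n → Bool, ∑ i, κ * ε * (B - blockSign L V t i * M V t i) := by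
    intro t ht
    have h1 : ∑ i, ∑ V : Fin m × Fin n → Bool, blockSign L V t i * M V t i ≤
        ∑ i, ∑ V : Fin m × Fin n → Bool, B * (1 / 4 + 24 * ε ^ 2 *
          ∑ τ ∈ Finset.range (m * L) with τ / L = t / L, S V i τ) :=
      Finset.sum_le_sum fun i _ => sum_blockSign_mul_noiseMean_le hX hB hL (Finset.mem_range.1 ht) i
    rw [Finset.sum_comm, Finset.sum_comm (s := Finset.univ (α := Fin n))] at h1
    have h2 : ∀ V : Fin m × Fin n → Bool, ∑ i, B * (1 / 4 + 24 * ε ^ 2 *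
          ∑ τ ∈ Finset.range (m * L) with τ / L = t / L, S V i τ)
          ≤ B * (1 / 4 * n + 48 * ε ^ 2 * L) := by
      intro V
      rw [← Finset.mul_sum, Finset.sum_add_distrib, ← Finset.mul_sum, Finset.sum_comm]
      have h3 : ∑ τ ∈ Finset.range (m * L) with τ / L = t / L, ∑ i, S V i τ ≤ L * 2 := by
        refine (Finset.sum_le_card_nsmul _ _ 2 fun τ _ =>
          A.sum_noiseMean_probe_le κ ω _ _ _).trans ?_
        rw [nsmul_eq_mul]
        gcongr
        exact card_filter_div_eq_le hL _ _
      have h4 := mul_le_mul_of_nonneg_left h3 (by positivity : 0 ≤ 24 * ε ^ 2)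
      refine mul_le_mul_of_nonneg_left ?_ hB
      simp only [Finset.sum_const, Finset.card_univ, Fintype.card_fin, nsmul_eq_mul]
      linarith
    have h5 := h1.trans (Finset.sum_le_sum fun V _ => h2 V)
    simp only [← Finset.mul_sum, Finset.sum_sub_distrib, Finset.sum_const, Finset.card_univ,
      Fintype.card_fin, nsmul_eq_mul] at h5 ⊢
    have h6 := mul_le_mul_of_nonneg_left h5 (mul_nonneg hκ hε)
    linarith
  refine le_trans (le_of_eq ?_) (Finset.sum_le_sum hcell)
  simp only [Finset.sum_const, Finset.card_range, nsmul_eq_mul]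
  ring

lemma integrable_prod_amplitude_sq_mul (μ : Measure Ω) [IsProbabilityMeasure μ] {N : ℕ}
    {R : Ω → (ℕ → Fin n → ℝ) → ℝ} (hR : Measurable fun p : Ω × (ℕ → Fin n → ℝ) => R p.1 p.2)
    {K : ℝ} (hK : ∀ ω ζ, (∀ t i, |ζ t i| ≤ 1) → |R ω ζ| ≤ K) :
    Integrable (fun p : Ω × (Fin N → Fin n → ℝ) => amplitude p.2 ^ 2 * R p.1 (extendZero p.2))
      (μ.prod volume) := by
  have hdom : Integrable (fun p : Ω × (Fin N → Fin n → ℝ) => K * amplitude p.2 ^ 2)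
      (μ.prod volume) :=
    Integrable.mul_prod (f := fun _ : Ω => K) (integrable_const K) integrable_amplitude_sq
  have hc : Measurable fun p : Ω × (Fin N → Fin n → ℝ) => (p.1, extendZero p.2) :=
    measurable_fst.prodMk (measurable_extendZero.comp measurable_snd)
  have hd : Measurable fun p : Ω × (Fin N → Fin n → ℝ) => amplitude p.2 ^ 2 :=
    (continuous_amplitude.measurable.comp measurable_snd).pow_const 2
  refine hdom.mono' (hd.mul (hR.comp hc)).aestronglyMeasurable (ae_of_all _ fun p => ?_)
  rw [Real.norm_eq_abs, abs_mul, abs_of_nonneg (sq_nonneg _), mul_comm]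
  rcases eq_or_ne (amplitude p.2) 0 with h | h
  · simp [h]
  · exact mul_le_mul_of_nonneg_right (hK _ _ (abs_extendZero_le_one h)) (sq_nonneg _)

/-- Some pattern of signs and some bounded noise force large expected regret. -/
lemma exists_signs_noise_le_integral {B : ℝ} (hX : ∀ x ∈ X, ∀ i : Fin n, |x i.succ| ≤ B)
    (hB : 0 ≤ B) (hκ : 0 ≤ κ) (hε : 0 ≤ ε) (hε1 : ε ≤ 1) (hL : 0 < L) {T : ℕ} (hT : m * L ≤ T)
    (u : (Fin m × Fin n → Bool) → ℕ → L1Space (n + 1))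
    (hu : ∀ V, ∀ t < m * L, ∀ i : Fin n, u V t i.succ = B * blockSign L V t i)
    (hub : ∀ V t, ∀ i : Fin n, |u V t i.succ| ≤ B)
    (μ : Measure Ω) [IsProbabilityMeasure μ] :
    ∃ (V : Fin m × Fin n → Bool) (ζ : ℕ → Fin n → ℝ), (∀ t i, |ζ t i| ≤ 1) ∧
      Integrable (A.dynamicRegret T (linLoss κ (ε • blockSign L V) ζ) (u V)) μ ∧
      κ * ε * B * (m * L : ℕ) * (3 / 4 * n - 48 * ε ^ 2 * L) ≤
        ∫ ω, A.dynamicRegret T (linLoss κ (ε • blockSign L V) ζ) (u V) ω ∂μ := by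
  set R : (Fin m × Fin n → Bool) → Ω → (ℕ → Fin n → ℝ) → ℝ := fun V ω ζ =>
    A.dynamicRegret T (linLoss κ (ε • blockSign L V) ζ) (u V) ω
  set K := T * (n * (κ * (4 * B)))
  have hθ : ∀ V : Fin m × Fin n → Bool, ∀ t i, |(ε • blockSign L V) t i| ≤ 1 := fun V t i => by
    simp only [Pi.smul_apply, smul_eq_mul, abs_mul, abs_of_nonneg hε]
    exact mul_le_one₀ hε1 (abs_nonneg _) (abs_blockSign_le V t i)
  have hRK : ∀ V ω ζ, (∀ t i, |ζ t i| ≤ 1) → |R V ω ζ| ≤ K := fun V ω ζ hζ =>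
    abs_dynamicRegret_le hX hκ (hθ V) (hub V) hζ
  have hRm : ∀ V, Measurable fun p : Ω × (ℕ → Fin n → ℝ) => R V p.1 p.2 := fun V =>
    A.measurable_dynamicRegret κ _ T (u V)
  have hjoint : ∀ V, Integrable (fun p : Ω × (Fin (m * L) → Fin n → ℝ) =>
      amplitude p.2 ^ 2 * R V p.1 (extendZero p.2)) (μ.prod volume) := fun V =>
    integrable_prod_amplitude_sq_mul μ (hRm V) (hRK V)
  have hsum : ∑ _V : Fin m × Fin n → Bool,
        κ * ε * B * (m * L : ℕ) * (3 / 4 * n - 48 * ε ^ 2 * L) ≤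
      ∑ V : Fin m × Fin n → Bool, ∫ ω, noiseMean (m * L) (R V ω) ∂μ := by
    have hi : ∀ V, Integrable (fun ω => noiseMean (m * L) (R V ω)) μ := fun V =>
      (hjoint V).integral_prod_left
    have hpt : ∀ ω, ∑ _V : Fin m × Fin n → Bool,
        κ * ε * B * (m * L : ℕ) * (3 / 4 * n - 48 * ε ^ 2 * L) ≤
        ∑ V : Fin m × Fin n → Bool, noiseMean (m * L) (R V ω) := fun ω =>
      sum_signs_noiseMean_regret_ge (A := A) (ω := ω) hX hB hκ hε hL hT u hu
    rw [← integral_finsetSum _ fun V _ => hi V]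
    have := integral_mono (μ := μ) (integrable_const _)
      (integrable_finsetSum _ fun V _ => hi V) hpt
    simpa only [integral_const, probReal_univ, one_smul] using this
  obtain ⟨V, -, hV⟩ := Finset.exists_le_of_sum_le Finset.univ_nonempty hsum
  simp only [noiseMean] at hV
  rw [integral_integral_swap (hjoint V)] at hV
  simp only [integral_const_mul] at hV
  have hi := (hjoint V).integral_prod_right
  simp only [integral_const_mul] at hi
  obtain ⟨z, hz, hle⟩ := exists_amplitude_ne_zero_le hi hV
  refine ⟨V, extendZero z, abs_extendZero_le_one hz, ?_, hle⟩
  refine Integrable.of_bound (C := K) ?_ (ae_of_all _ fun ω => hRK V ω _ (abs_extendZero_le_one hz))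
  exact ((hRm V).comp (measurable_id.prodMk measurable_const)).aestronglyMeasurable

end TwoPointAlgorithm

end

/-! ### Feasible set, losses and comparators -/

section

variable {n m L : ℕ}

lemma norm_eq_sum_abs {d : ℕ} (x : L1Space d) : ‖x‖ = ∑ i, |x i| := by
  simp [PiLp.norm_eq_of_L1]

/-- The feasible set: a box that is wide in coordinate `0` and has width `1 / (n + 1)` in the others. -/
def feasibleBox (n : ℕ) : Set (L1Space (n + 1)) :=
  {x | |x 0| ≤ 1 / 3 ∧ ∀ i : Fin n, |x i.succ| ≤ 1 / (2 * (n + 1))}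

lemma feasibleBox_subset_ball : feasibleBox n ⊆ Metric.ball 0 1 := by
  intro x hx
  rw [mem_ball_zero_iff, norm_eq_sum_abs, Fin.sum_univ_succ]
  have h : ∑ i : Fin n, |x i.succ| ≤ n * (1 / (2 * (n + 1))) :=
    (Finset.sum_le_card_nsmul _ _ _ fun i _ => hx.2 i).trans (by simp)
  have h2 : (n : ℝ) * (1 / (2 * (n + 1))) ≤ 1 / 2 := by
    rw [mul_one_div, div_le_div_iff₀ (by positivity) (by norm_num)]
    linarith
  linarith [hx.1]

lemma isFeasibleSet_feasibleBox (hn : 1 ≤ n) : IsFeasibleSet (feasibleBox n) where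
  isCompact := by
    refine Metric.isCompact_of_isClosed_isBounded ?_
      (Metric.isBounded_ball.subset feasibleBox_subset_ball)
    have h : feasibleBox n = {x | |x 0| ≤ 1 / 3}
        ∩ ⋂ i : Fin n, {x | |x i.succ| ≤ 1 / (2 * ((n : ℝ) + 1))} := by
      ext x; simp [feasibleBox]
    rw [h]
    exact (isClosed_le (by fun_prop) (by fun_prop)).inter
      (isClosed_iInter fun i => isClosed_le (by fun_prop) (by fun_prop))
  convex := by
    have key : ∀ {c p q a b : ℝ}, |p| ≤ c → |q| ≤ c → 0 ≤ a → 0 ≤ b → a + b = 1 →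
        |a * p + b * q| ≤ c := fun {c p q a b} hp hq ha hb hab => by
      calc |a * p + b * q| ≤ a * |p| + b * |q| := by
            simpa [abs_mul, abs_of_nonneg ha, abs_of_nonneg hb] using abs_add_le (a * p) (b * q)
        _ ≤ a * c + b * c := by gcongr
        _ = c := by rw [← add_mul, hab, one_mul]
    intro x hx y hy a b ha hb hab
    exact ⟨key hx.1 hy.1 ha hb hab, fun i => key (hx.2 i) (hy.2 i) ha hb hab⟩
  exists_ball_subset := by
    refine ⟨1 / (2 * (n + 1)), by positivity, fun x hx => ?_⟩
    rw [mem_ball_zero_iff] at hx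
    have h : ∀ i, |x i| ≤ 1 / (2 * (n + 1)) := fun i => (PiLp.norm_apply_le x i).trans hx.le
    refine ⟨(h 0).trans ?_, fun i => h i.succ⟩
    have : (1 : ℝ) ≤ n := by exact_mod_cast hn
    exact one_div_le_one_div_of_le (by norm_num) (by linarith)
  subset_ball := feasibleBox_subset_ball

lemma isLoss_linLoss {G : ℝ} (hG : 0 ≤ G) {θ ζ : ℕ → Fin n → ℝ} (hθ : ∀ t i, |θ t i| ≤ 1)
    (hζ : ∀ t i, |ζ t i| ≤ 1) (X : Set (L1Space (n + 1))) (t : ℕ) :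
    IsLoss X G (linLoss (G / 2) θ ζ t) where
  convexOn := by
    refine ⟨convex_univ, fun x _ y _ a b _ _ _ => le_of_eq ?_⟩
    have : tailCoords (a • x + b • y) = a • tailCoords x + b • tailCoords y := by
      ext i; simp [tailCoords]
    simp only [linLoss, this, dotProduct_add, dotProduct_smul, smul_eq_mul]
    ring
  lipschitz x _ y _ := by
    have h1 : linLoss (G / 2) θ ζ t x - linLoss (G / 2) θ ζ t y
        = ∑ i : Fin n, G / 2 * ((ζ t i - θ t i) * (x i.succ - y i.succ)) := by
      simp only [linLoss, ← mul_sub, ← dotProduct_sub, ← Finset.mul_sum]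
      rfl
    rw [h1, norm_eq_sum_abs, Fin.sum_univ_succ]
    have h2 : ∀ i : Fin n, |G / 2 * ((ζ t i - θ t i) * (x i.succ - y i.succ))|
        ≤ G * |(x - y) i.succ| := fun i => by
      rw [abs_mul, abs_mul, abs_of_nonneg (by positivity : 0 ≤ G / 2)]
      have h3 : |ζ t i - θ t i| ≤ 2 := (abs_sub _ _).trans (by linarith [hζ t i, hθ t i])
      have h4 := mul_le_mul_of_nonneg_right h3 (abs_nonneg ((x - y) i.succ))
      have h5 := mul_le_mul_of_nonneg_left h4 (by positivity : 0 ≤ G / 2)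
      calc _ ≤ G / 2 * (2 * |(x - y) i.succ|) := h5
        _ = _ := by ring
    refine ((Finset.abs_sum_le_sum_abs _ _).trans (Finset.sum_le_sum fun i _ => h2 i)).trans ?_
    rw [← Finset.mul_sum]
    exact mul_le_mul_of_nonneg_left (le_add_of_nonneg_left (abs_nonneg _)) hG

/-- The comparator of round `t`: it follows the signs in the coordinates that the losses depend on,
keeping the last ones after the end of the last block, and oscillates between `a` and `-a` in
coordinate `0`. -/
def comparator (m L : ℕ) (B a : ℝ) (V : Fin m × Fin n → Bool) (t : ℕ) : L1Space (n + 1) :=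
  WithLp.toLp 1 (Fin.cons ((-1) ^ t * a)
    fun i => B * blockSign L V (min t (m * L - 1)) i)

@[simp] lemma comparator_zero (B a : ℝ) (V : Fin m × Fin n → Bool) (t : ℕ) :
    comparator m L B a V t 0 = (-1) ^ t * a := rfl

@[simp] lemma comparator_succ (B a : ℝ) (V : Fin m × Fin n → Bool) (t : ℕ) (i : Fin n) :
    comparator m L B a V t i.succ = B * blockSign L V (min t (m * L - 1)) i := rfl

/-- The part of the path variation of the comparators that is due to changes of sign. -/
def switchCost (m L T : ℕ) (B : ℝ) (V : Fin m × Fin n → Bool) : ℝ :=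
  ∑ t ∈ Finset.range (T - 1), ∑ i, B * |blockSign L V (min (t + 1) (m * L - 1)) i
    - blockSign L V (min t (m * L - 1)) i|

lemma abs_blockSign_sub_le (V : Fin m × Fin n → Bool) {s t : ℕ} (hst : s ≤ t) (i : Fin n) :
    |blockSign L V t i - blockSign L V s i| ≤ 2 * (((t / L : ℕ) : ℝ) - ((s / L : ℕ) : ℝ)) := by
  rcases (Nat.div_le_div_right (c := L) hst).eq_or_lt with h | h
  · simp [blockSign, h]
  · have h1 : ((s / L : ℕ) : ℝ) + 1 ≤ ((t / L : ℕ) : ℝ) := by exact_mod_cast h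
    have h2 := (abs_sub (blockSign L V t i) (blockSign L V s i))
    linarith [abs_blockSign_le (L := L) V t i, abs_blockSign_le (L := L) V s i]

lemma switchCost_le {B : ℝ} (hB : 0 ≤ B) (hm : 0 < m) (hL : 0 < L) (T : ℕ)
    (V : Fin m × Fin n → Bool) : switchCost m L T B V ≤ n * B * 2 * ((m : ℝ) - 1) := by
  have h1 : ∀ t ∈ Finset.range (T - 1), ∑ i, B * |blockSign L V (min (t + 1) (m * L - 1)) i
      - blockSign L V (min t (m * L - 1)) i| ≤ n * B * 2 *
      (((min (t + 1) (m * L - 1) / L : ℕ) : ℝ) - ((min t (m * L - 1) / L : ℕ) : ℝ)) := by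
    intro t _
    refine (Finset.sum_le_card_nsmul _ _ (B * (2 *
      (((min (t + 1) (m * L - 1) / L : ℕ) : ℝ) - ((min t (m * L - 1) / L : ℕ) : ℝ))))
      fun i _ => mul_le_mul_of_nonneg_left (abs_blockSign_sub_le V ?_ i) hB).trans (le_of_eq ?_)
    · exact min_le_min_right _ t.le_succ
    · simp only [Finset.card_univ, Fintype.card_fin, nsmul_eq_mul]
      ring
  refine (Finset.sum_le_sum h1).trans ?_
  rw [← Finset.mul_sum, Finset.sum_range_sub
    (f := fun t => ((min t (m * L - 1) / L : ℕ) : ℝ))]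
  refine mul_le_mul_of_nonneg_left ?_ (by positivity)
  have h2 : min (T - 1) (m * L - 1) / L ≤ m - 1 := by
    refine (Nat.div_le_div_right (min_le_right _ _)).trans (Nat.le_sub_one_of_lt ?_)
    rw [Nat.div_lt_iff_lt_mul hL]
    have := Nat.mul_pos hm hL
    omega
  have h3 : ((min (T - 1) (m * L - 1) / L : ℕ) : ℝ) ≤ (m : ℝ) - 1 := by
    have : ((min (T - 1) (m * L - 1) / L : ℕ) : ℝ) ≤ ((m - 1 : ℕ) : ℝ) := by exact_mod_cast h2
    rwa [Nat.cast_sub hm, Nat.cast_one] at this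
  simpa using h3

lemma switchCost_nonneg {B : ℝ} (hB : 0 ≤ B) (T : ℕ) (V : Fin m × Fin n → Bool) :
    0 ≤ switchCost m L T B V :=
  Finset.sum_nonneg fun _ _ => Finset.sum_nonneg fun _ _ => mul_nonneg hB (abs_nonneg _)

lemma pathVariation_comparator {B a : ℝ} (hB : 0 ≤ B) (ha : 0 ≤ a) (T : ℕ)
    (V : Fin m × Fin n → Bool) :
    pathVariation T (comparator m L B a V) = (T - 1 : ℕ) * (2 * a) + switchCost m L T B V := by
  have h : ∀ t, ‖comparator m L B a V (t + 1) - comparator m L B a V t‖ = 2 * a +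
      ∑ i, B * |blockSign L V (min (t + 1) (m * L - 1)) i
        - blockSign L V (min t (m * L - 1)) i| := fun t => by
    rw [norm_eq_sum_abs, Fin.sum_univ_succ]
    congr 1
    · simp only [PiLp.sub_apply, comparator_zero]
      rw [pow_succ, show (-1 : ℝ) ^ t * -1 * a - (-1) ^ t * a = (-1) ^ t * (-(2 * a)) by ring,
        abs_mul, abs_pow, abs_neg, abs_one, one_pow, one_mul, abs_neg, abs_of_nonneg (by positivity)]
    · refine Finset.sum_congr rfl fun i _ => ?_
      simp only [PiLp.sub_apply, comparator_succ]
      rw [← mul_sub, abs_mul, abs_of_nonneg hB]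
  simp only [pathVariation, h, Finset.sum_add_distrib, switchCost, Finset.sum_const,
    Finset.card_range, nsmul_eq_mul]

/-- The lower bound for positive path variation and an arbitrary Lipschitz constant `G`. -/
lemma exists_losses_comparators (hn : 2 ≤ n) {G : ℝ} (hG : 0 ≤ G) {T : ℕ} {P : ℝ} (hP : 0 < P)
    (hPT : P ≤ (T : ℝ) - 1) (hdP : ((n : ℝ) + 1) * P ≤ T) {Ω : Type*} [MeasurableSpace Ω]
    (μ : Measure Ω) [IsProbabilityMeasure μ] (A : TwoPointAlgorithm (n + 1) (feasibleBox n) Ω) :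
    ∃ (f : ℕ → L1Space (n + 1) → ℝ) (u : ℕ → L1Space (n + 1)),
      (∀ t, IsLoss (feasibleBox n) G (f t)) ∧ (∀ t, u t ∈ feasibleBox n) ∧
      pathVariation T u = P ∧ Integrable (A.dynamicRegret T f u) μ ∧
      1 / 300 * (G * √((n + 1) * P * T)) ≤ ∫ ω, A.dynamicRegret T f u ω ∂μ := by
  have hn' : (2 : ℝ) ≤ n := by exact_mod_cast hn
  have hT2 : 2 ≤ T := by
    have : (1 : ℝ) < T := by linarith
    exact_mod_cast this
  have hT2' : (2 : ℝ) ≤ T := by exact_mod_cast hT2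
  have hP3 : 3 * P ≤ T := le_trans (by nlinarith) hdP
  set m := ⌊P⌋₊ + 1 with hm
  set L := T / m with hLdef
  have hm0 : 0 < m := Nat.succ_pos _
  have hPm : P ≤ m := by
    rw [hm]; push_cast; exact (Nat.lt_floor_add_one P).le
  have hmP : (m : ℝ) - 1 ≤ P := by
    rw [hm]; push_cast; linarith [Nat.floor_le hP.le]
  have hmT : m ≤ T := by
    have : (m : ℝ) < T + 1 := by linarith
    have : m < T + 1 := by exact_mod_cast this
    omega
  have hL : 0 < L := Nat.div_pos hmT hm0
  have hL' : (1 : ℝ) ≤ L := by exact_mod_cast hL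
  have hm1 : (1 : ℝ) ≤ m := by exact_mod_cast hm0
  have hmL : m * L ≤ T := Nat.mul_div_le T m
  have hTmL : (T : ℝ) ≤ 2 * (m * L) := by
    have h := Nat.lt_mul_div_succ T hm0
    have : (T : ℝ) < m * (L + 1) := by exact_mod_cast h
    nlinarith
  set B : ℝ := 1 / (2 * (n + 1)) with hBdef
  have hB : 0 ≤ B := by positivity
  -- The largest drift at most `1` for which a block of `L` rounds does not reveal the signs: the
  -- information term `48 ε ^ 2 L` stays below a third of the term `3 n / 4` it is subtracted from.
  set ε : ℝ := min 1 (√(n / (192 * L))) with hεdef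
  have hε : 0 ≤ ε := le_min zero_le_one (Real.sqrt_nonneg _)
  have hε1 : ε ≤ 1 := min_le_left _ _
  have hεL : 48 * ε ^ 2 * L ≤ n / 4 := by
    have h1 : ε ^ 2 ≤ n / (192 * L) := by
      calc ε ^ 2 ≤ √(n / (192 * L)) ^ 2 := by gcongr; exact min_le_right _ _
        _ = _ := Real.sq_sqrt (by positivity)
    rw [le_div_iff₀ (by positivity)] at h1
    linarith
  -- The sign changes cost at most `P`, and the oscillation in coordinate `0` takes up the rest.
  have hcost : ∀ V : Fin m × Fin n → Bool, switchCost m L T B V ≤ P := fun V => by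
    refine (switchCost_le hB hm0 hL T V).trans (le_trans ?_ hmP)
    have : n * B * 2 ≤ 1 := by
      rw [hBdef, mul_one_div, div_mul_eq_mul_div, div_le_one (by positivity)]
      linarith
    nlinarith
  set a : (Fin m × Fin n → Bool) → ℝ := fun V =>
    (P - switchCost m L T B V) / (2 * ((T : ℝ) - 1)) with ha
  have ha0 : ∀ V, 0 ≤ a V := fun V =>
    div_nonneg (sub_nonneg.2 (hcost V)) (by linarith)
  have ha1 : ∀ V, a V ≤ 1 / 3 := fun V => by
    rw [ha, div_le_iff₀ (by linarith)]
    linarith [switchCost_nonneg (L := L) hB T V]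
  set u : (Fin m × Fin n → Bool) → ℕ → L1Space (n + 1) := fun V =>
    comparator m L B (a V) V with hu
  have hub : ∀ V t, ∀ i : Fin n, |u V t i.succ| ≤ B := fun V t i => by
    rw [hu]
    simp only [comparator_succ]
    rw [abs_mul, abs_of_nonneg hB]
    exact mul_le_of_le_one_right hB (abs_blockSign_le V _ i)
  obtain ⟨V, ζ, hζ, hint, hreg⟩ := TwoPointAlgorithm.exists_signs_noise_le_integral (A := A)
    (κ := G / 2) (ε := ε) (B := B) (m := m) (L := L) (T := T)
    (fun x hx i => hx.2 i) hB (by positivity) hε hε1 hL hmL u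
    (fun V t ht i => by
      rw [hu]
      simp only [comparator_succ]
      rw [min_eq_left (by omega)]) hub μ
  refine ⟨_, u V, fun t => isLoss_linLoss hG (fun t i => ?_) hζ _ t, fun t => ⟨?_, hub V t⟩, ?_,
    hint, le_trans ?_ hreg⟩
  · simp only [Pi.smul_apply, smul_eq_mul, abs_mul, abs_of_nonneg hε]
    exact mul_le_one₀ hε1 (abs_nonneg _) (abs_blockSign_le V t i)
  · rw [hu]
    simp only [comparator_zero]
    rw [abs_mul, abs_pow, abs_neg, abs_one, one_pow, one_mul, abs_of_nonneg (ha0 V)]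
    exact ha1 V
  · rw [hu, pathVariation_comparator hB (ha0 V), Nat.cast_sub (by omega), Nat.cast_one, ha]
    have : (T : ℝ) - 1 ≠ 0 := by linarith
    field_simp
    ring
  -- If `ε = 1`, this is `(n + 1) P ≤ T`; otherwise it is `ε ^ 2 L = n / 192`.
  · have hsq : √((n + 1) * P * T) ≤ 24 * (ε * (m * L)) := by
      rw [Real.sqrt_le_left (by positivity)]
      have hmLT : (0 : ℝ) ≤ m * L := by positivity
      have hdPT : ((n : ℝ) + 1) * P * T ≤ T * T := mul_le_mul_of_nonneg_right hdP (by linarith)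
      rcases le_total 1 (√(n / (192 * L))) with h | h
      · rw [hεdef, min_eq_left h]
        nlinarith
      · have h1 : ε ^ 2 * L = n / 192 := by
          rw [hεdef, min_eq_right h, Real.sq_sqrt (by positivity)]
          field_simp
        have h2 : (24 * (ε * (m * L))) ^ 2 = 3 * n * (m * (m * L)) := by
          linear_combination 576 * m ^ 2 * L * h1
        rw [h2]
        have h3 : P * T ≤ 2 * (m * (m * L)) := by
          calc P * T ≤ m * (2 * (m * L)) := mul_le_mul hPm hTmL (by linarith) (by linarith)
            _ = _ := by ring
        have h4 : ((n : ℝ) + 1) * (P * T) ≤ 3 / 2 * n * (2 * (m * (m * L))) :=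
          mul_le_mul (by linarith) h3 (by positivity) (by positivity)
        linarith
    have hnB : 1 / 12 ≤ B * n / 4 := by
      rw [hBdef, one_div_mul_eq_div, div_div, div_le_div_iff₀ (by norm_num) (by positivity)]
      linarith
    have hεm : 0 ≤ ε * (m * L) := by positivity
    calc 1 / 300 * (G * √((n + 1) * P * T))
        ≤ 1 / 300 * (G * (24 * (ε * (m * L)))) := by gcongr
      _ ≤ 1 / 12 * (G * (ε * (m * L))) := by nlinarith [mul_nonneg hG hεm]
      _ ≤ B * n / 4 * (G * (ε * (m * L))) :=
          mul_le_mul_of_nonneg_right hnB (mul_nonneg hG hεm)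
      _ = G / 2 * ε * B * (m * L : ℕ) * (n / 2) := by push_cast; ring
      _ ≤ _ := by
          refine mul_le_mul_of_nonneg_left ?_ (by positivity)
          linarith

end

end BCO

end

theorem mainTheorem5 :
    ∃ C : ℝ, 0 < C ∧ ∀ d : ℕ, 3 ≤ d →
      ∃ X : Set (BCO.L1Space d), BCO.IsFeasibleSet X ∧
        ∀ (T : ℕ) (P : ℝ), 0 ≤ P → P ≤ (T : ℝ) - 1 → (d : ℝ) * P ≤ T →
        ∀ (Ω : Type*) [MeasurableSpace Ω] (μ : MeasureTheory.Measure Ω)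
          [MeasureTheory.IsProbabilityMeasure μ] (A : BCO.TwoPointAlgorithm d X Ω),
        ∃ (f : ℕ → BCO.L1Space d → ℝ) (u : ℕ → BCO.L1Space d),
          (∀ t < T, BCO.IsLoss X (Real.sqrt (Real.log d)⁻¹) (f t)) ∧
          (∀ t < T, u t ∈ X) ∧
          BCO.pathVariation T u = P ∧
          MeasureTheory.Integrable (A.dynamicRegret T f u) μ ∧
          C * Real.sqrt (d * (Real.log d)⁻¹ * P * T) ≤ ∫ ω, A.dynamicRegret T f u ω ∂μ := by
  refine ⟨1 / 300, by norm_num, fun d hd => ?_⟩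
  obtain ⟨n, rfl⟩ : ∃ n, d = n + 1 := ⟨d - 1, by omega⟩
  refine ⟨BCO.feasibleBox n, BCO.isFeasibleSet_feasibleBox (by omega), ?_⟩
  intro T P hP hPT hdP Ω _ μ _ A
  rcases hP.eq_or_lt with rfl | hP
  · refine ⟨fun _ _ => 0, fun _ => 0, fun t _ => ⟨convexOn_const 0 convex_univ, fun x _ y _ => ?_⟩,
      fun t _ => ⟨by simp, fun i => ?_⟩, by simp [BCO.pathVariation], ?_, ?_⟩
    · rw [sub_self, abs_zero]
      exact mul_nonneg (Real.sqrt_nonneg _) (norm_nonneg (x - y))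
    · rw [PiLp.zero_apply, abs_zero]
      positivity
    · have h0 : A.dynamicRegret T (fun _ _ => 0) (fun _ => 0) = 0 := by
        ext ω; simp [BCO.TwoPointAlgorithm.dynamicRegret]
      rw [h0]
      exact MeasureTheory.integrable_zero _ _ _
    · simp [BCO.TwoPointAlgorithm.dynamicRegret]
  · push_cast at hdP
    obtain ⟨f, u, hf, hu, hp, hi, hr⟩ := BCO.exists_losses_comparators (by omega)
      (Real.sqrt_nonneg (Real.log ((n + 1 : ℕ) : ℝ))⁻¹) hP hPT hdP μ A
    refine ⟨f, u, fun t _ => hf t, fun t _ => hu t, hp, hi, le_trans (le_of_eq ?_) hr⟩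
    rw [← Real.sqrt_mul (inv_nonneg.2 (Real.log_natCast_nonneg _))]
    congr 2
    push_cast
    ring
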